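/- Let $\mathbb L/\mathbb K$ be a cyclic Galois extension of fields of degree $n$, let $\sigma$ be a generator of its Galois group, and let $R=\mathbb L[x;\sigma]$ be the twisted polynomial ring, in which $xa=\sigma(a)x$ for $a\in\mathbb L$. Let $\rho$ be a field automorphism of $\mathbb L$, put $\mathbb K'=\mathrm{Fix}(\rho)\cap\mathbb K$, and assume $[\mathbb K:\mathbb K']<\infty$. Here $\mathrm{Fix}(\psi)=\{a\in\mathbb L:\psi(a)=a\}$. Let $F(y)\in\mathbb K[y]$ be monic and irreducible of degree $s$ with $F(y)\neq y$, let $f\in R$ be a monic irreducible (right) divisor of $F(x^n)$ with $f\notin Z(R)$ and constant coefficient $f_0$, let $m$ be the number of factors in a factorisation of $F(x^n)$ into irreducible elements of $R$, and put $\ell=n/m$ (it is known that $m\mid n$ and $\deg f=s\ell$). Let $R_F=R/RF(x^n)$, let $E_F=Z(R_F)$, and let $\mathcal E(f)=\{g\in R: fg\in Rf\}/Rf$ be the eigenring of $f$. **(1) Codes.** For $k\ge1$ and $\eta\in\mathbb L$ let $$\mathcal C=S_{n,s\ell,k}(\eta,\rho,F)=\Big\{\sum_{i=0}^{sk\ell-1}a_ix^i+\eta\,\rho(a_0)x^{sk\ell}+RF(x^n):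 a_i\in\mathbb L\Big\}\subseteq R_F ,$$ and let $\mathcal I_\ell(\mathcal C)=\{a\in R_F:a\mathcal C\subseteq\mathcal C\}$, $\mathcal I_r(\mathcal C)=\{b\in R_F:\mathcal Cb\subseteq\mathcal C\}$, $C(\mathcal C)=\{a\in R_F: ac=ca\ \text{for all }c\in\mathcal C\}$ and $Z(\mathcal C)=\mathcal I_\ell(\mathcal C)\cap C(\mathcal C)$. Assume $k\le m/2$ and $sk\ell>2$. * If $\eta\ne0$, then, as $\mathbb K'$-algebras, $\mathcal I_\ell(\mathcal C)\cong\mathrm{Fix}(\rho)$, $\mathcal I_r(\mathcal C)\cong\mathrm{Fix}(\rho^{-1}\circ\sigma^{sk\ell})$, $C(\mathcal C)\cong E_F$ and $Z(\mathcal C)\cong\mathbb K'$. * If $\eta=0$, then $\mathcal I_\ell(\mathcal C)=\mathcal I_r(\mathcal C)=\mathbb L$ and $Z(\mathcal C)=\mathbb K$ (as sets of classes of constant polynomials), and $C(\mathcal C)\cong E_F$ as $\mathbb K'$-algebras. **(2) Algebras.** Let $\eta\in\mathbb L$, $\eta\neq0$, with $\mathrm N_{\mathbb L/\mathbb K'}(\eta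 f_0)\ne1$, assume $s\ell>2$, and let $z(x^n)\in Z(R)=\mathbb K[x^n]$ be such that $z(x^n)x^{sn}\equiv1$ modulo $Rf$. Every element of $R/Rf$ is uniquely the class of a polynomial $(a_0-\eta\rho(a_0)f_0)+\sum_{i=1}^{s\ell-1}a_ix^i$ with $a_i\in\mathbb L$. Let $\mathbb A=(R/Rf,\star_{S'})$ be the $\mathbb K'$-algebra with $$\Big((a_0-\eta\rho(a_0)f_0)+\sum_{i=1}^{s\ell-1}a_ix^i\Big)\star_{S'}b=\Big((a_0-\eta\rho(a_0)f_0)+\sum_{i=1}^{s\ell-1}a_ix^i+\eta\rho(a_0)f\Big)\,z(x^n)x^{sn-1}\,b .$$ Then $\mathbb A$ is a unital division algebra with unity $x$ and, as $\mathbb K'$-algebras, $$\mathbb N_l(\mathbb A)\cong\mathrm{Fix}(\rho),\quad \mathbb N_m(\mathbb A)\cong\mathrm{Fix}(\rho^{-1}\circ\sigma^{s\ell}),\quad \mathbb N_r(\mathbb A)\cong\mathcal E(f),\quad Z(\mathbb A)\cong\mathbb K' ,$$ where $\mathbb N_l,\mathbb N_m,\mathbb N_r$ are the left, middle and right nuclei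 (the elements $a$, respectively $b$, $c$, such that $a\star(b\star c)=(a\star b)\star c$ for all values of the other two variables), and the centre $Z(\mathbb A)$ consists of the elements of all three nuclei that commute with every element of $\mathbb A$. -/

import Mathlib

open Polynomial

noncomputable section

/-! ### Nuclei and centre of a nonassociative algebra -/

section Nuclei

variable (k A : Type*) [CommRing k] [NonUnitalNonAssocRing A] [Module k A] [IsScalarTower k A A]
  [SMulCommClass k A A]

/-- The left nucleus `{a | a (b c) = (a b) c for all b, c}`. -/
def leftNucleus : NonUnitalSubalgebra k A where
  carrier := {a | ∀ b c : A, a * (b * c) = a * b * c}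
  add_mem' ha hb c d := by simp only [add_mul, ha c d, hb c d]
  zero_mem' b c := by simp
  mul_mem' {a a'} ha ha' b c := by rw [← ha, ha', ha, ha]
  smul_mem' r a ha b c := by simp only [smul_mul_assoc, ha b c]

/-- The middle nucleus `{b | a (b c) = (a b) c for all a, c}`. -/
def middleNucleus : NonUnitalSubalgebra k A where
  carrier := {b | ∀ a c : A, a * (b * c) = a * b * c}
  add_mem' ha hb c d := by simp only [add_mul, mul_add, ha c d, hb c d]
  zero_mem' b c := by simp
  mul_mem' {b b'} hb hb' a c := by rw [← hb', hb, hb', hb]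
  smul_mem' r b hb a c := by simp only [smul_mul_assoc, mul_smul_comm, hb a c]

/-- The right nucleus `{c | a (b c) = (a b) c for all a, b}`. -/
def rightNucleus : NonUnitalSubalgebra k A where
  carrier := {c | ∀ a b : A, a * (b * c) = a * b * c}
  add_mem' ha hb c d := by simp only [mul_add, ha c d, hb c d]
  zero_mem' b c := by simp
  mul_mem' {c c'} hc hc' a b := by rw [hc', hc', hc, hc']
  smul_mem' r c hc a b := by simp only [mul_smul_comm, hc a b]

/-- The centre: the elements of the nucleus (the intersection of the three nuclei) that commute
with every element. -/
def nonassocCentre : NonUnitalSubalgebra k A where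
  carrier := {a | a ∈ leftNucleus k A ⊓ middleNucleus k A ⊓ rightNucleus k A ∧
    ∀ b : A, a * b = b * a}
  add_mem' ha hb := ⟨add_mem ha.1 hb.1, fun c => by simp only [add_mul, mul_add, ha.2 c, hb.2 c]⟩
  zero_mem' := ⟨zero_mem _, fun b => by simp⟩
  mul_mem' {a b} ha hb := ⟨mul_mem ha.1 hb.1, fun c => by
    rw [← ha.1.1.1 b c, hb.2 c, ha.1.1.1 c b, ha.2 c, ← ha.1.1.2 c b]⟩
  smul_mem' r a ha := ⟨SMulMemClass.smul_mem r ha.1, fun b => by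
    simp only [smul_mul_assoc, mul_smul_comm, ha.2 b]⟩

end Nuclei

/-- `A` and `B` are isomorphic as `k`-algebras: there is a `k`-linear bijection that preserves
products (hence also identity elements, when there are any). -/
def IsoAsAlgebras (k A B : Type*) [CommRing k] [NonUnitalNonAssocRing A]
    [NonUnitalNonAssocRing B] [Module k A] [Module k B] : Prop :=
  ∃ e : A ≃ₗ[k] B, ∀ x y : A, e (x * y) = e x * e y

/-! ### Idealisers, centraliser and centre of a linear code -/

section Codes

variable {k S : Type*} [CommRing k] [Ring S] [Algebra k S]

/-- The left idealiser `{a | a 𝒞 ⊆ 𝒞}`. -/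
def leftIdealiser (𝒞 : Submodule k S) : Subalgebra k S where
  carrier := {a | ∀ c ∈ 𝒞, a * c ∈ 𝒞}
  mul_mem' ha hb c hc := by rw [mul_assoc]; exact ha _ (hb c hc)
  add_mem' ha hb c hc := by rw [add_mul]; exact 𝒞.add_mem (ha c hc) (hb c hc)
  algebraMap_mem' r c hc := by rw [← Algebra.smul_def]; exact 𝒞.smul_mem r hc

/-- The right idealiser `{b | 𝒞 b ⊆ 𝒞}`. -/
def rightIdealiser (𝒞 : Submodule k S) : Subalgebra k S where
  carrier := {b | ∀ c ∈ 𝒞, c * b ∈ 𝒞}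
  mul_mem' ha hb c hc := by rw [← mul_assoc]; exact hb _ (ha c hc)
  add_mem' ha hb c hc := by rw [mul_add]; exact 𝒞.add_mem (ha c hc) (hb c hc)
  algebraMap_mem' r c hc := by
    rw [← Algebra.commutes, ← Algebra.smul_def]; exact 𝒞.smul_mem r hc

/-- The centraliser `{a | a c = c a for all c ∈ 𝒞}`. -/
def codeCentraliser (𝒞 : Submodule k S) : Subalgebra k S :=
  Subalgebra.centralizer k (𝒞 : Set S)

/-- The centre: the intersection of the left idealiser and the centraliser. -/
def codeCentre (𝒞 : Submodule k S) : Subalgebra k S :=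
  leftIdealiser 𝒞 ⊓ codeCentraliser 𝒞

end Codes

/-! ### The eigenring -/

section Eigenring

variable (k : Type*) {S : Type*} [CommRing k] [Ring S] [Algebra k S]

/-- The left idealiser `I(f) = {g | f g ∈ S f}` of an element, the largest subring of `S` in which
`S f` is a two-sided ideal. In a noncommutative ring, `Ideal` means left ideal. -/
def elementIdealiser (f : S) : Subalgebra k S where
  carrier := {g | f * g ∈ Ideal.span {f}}
  mul_mem' {a b} ha hb := by
    obtain ⟨c, hc⟩ := Ideal.mem_span_singleton'.1 ha
    change f * (a * b) ∈ Ideal.span {f}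
    rw [← mul_assoc, ← hc, mul_assoc]
    exact Ideal.mul_mem_left _ _ hb
  add_mem' {a b} ha hb := by
    change f * (a + b) ∈ Ideal.span {f}
    rw [mul_add]
    exact add_mem ha hb
  algebraMap_mem' r := by
    change f * algebraMap k S r ∈ Ideal.span {f}
    rw [← Algebra.commutes]
    exact Ideal.mul_mem_left _ _ (Ideal.mem_span_singleton_self f)

/-- The ideal `S f` of `I(f)`. -/
def idealInIdealiser (f : S) : Ideal (elementIdealiser k f) :=
  (Ideal.span {f}).comap (elementIdealiser k f).subtype

instance (f : S) : (idealInIdealiser k f).IsTwoSided where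
  mul_mem_of_left {a} b ha := by
    obtain ⟨c, hc⟩ := Ideal.mem_span_singleton'.1 (Ideal.mem_comap.1 ha)
    refine Ideal.mem_comap.2 ?_
    rw [map_mul, ← hc, mul_assoc]
    exact Ideal.mul_mem_left _ _ b.2

/-- The eigenring `ℰ(f) = I(f) / S f`. -/
abbrev Eigenring (f : S) : Type _ := elementIdealiser k f ⧸ idealInIdealiser k f

end Eigenring

/-! ### The twisted polynomial ring `R = L[x; σ]` -/

section SkewPolynomialRing

variable {K L : Type*} [Field K] [Field L] [Algebra K L]

/-- The action of the monoid `ℕ` on `L` in which `n` acts as `σ ^ n`. -/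
abbrev powAction (σ : L ≃ₐ[K] L) : MulSemiringAction (Multiplicative ℕ) L :=
  MulSemiringAction.compHom L (powersHom (L ≃ₐ[K] L) σ)

/-- The twisted polynomial ring `L[x; σ]`, in which `x a = σ(a) x`: Mathlib's ring of skew
polynomials for the action of `ℕ` on `L` through the powers of `σ`. -/
def TwistedPoly (_σ : L ≃ₐ[K] L) : Type _ := SkewPolynomial L

namespace TwistedPoly

variable {σ : L ≃ₐ[K] L}

instance instRing : Ring (TwistedPoly σ) :=
  letI := powAction σ
  inferInstanceAs (Ring (SkewPolynomial L))

variable (σ) in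
/-- Constant polynomials. -/
def C : L →+* TwistedPoly σ :=
  letI := powAction σ
  SkewPolynomial.CRingHom

variable (σ) in
/-- The indeterminate `x`. -/
def X : TwistedPoly σ := SkewPolynomial.X

/-- The coefficient of `x ^ i` (coefficients are written on the left). -/
def coeff (p : TwistedPoly σ) (i : ℕ) : L := SkewPolynomial.coeff p i

/-- The degree (with value `0` at the zero polynomial). -/
def natDegree (p : TwistedPoly σ) : ℕ := (SkewPolynomial.support p).sup id

/-- The leading coefficient is `1`. -/
def Monic (p : TwistedPoly σ) : Prop := p.coeff p.natDegree = 1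

theorem coeff_C_mul_X_pow_mul (a : L) (n : ℕ) (p : TwistedPoly σ) (i : ℕ) :
    (C σ a * X σ ^ n * p).coeff i = if n ≤ i then a * (σ ^ n) (p.coeff (i - n)) else 0 := by
  let _ := powAction σ
  have h1 : C σ a * X σ ^ n = SkewMonoidAlgebra.single (Multiplicative.ofAdd n) a := by
    have := SkewPolynomial.monomial_mul_X_pow (R := L) 0 a n
    rw [zero_add] at this
    exact this
  have h2 : (C σ a * X σ ^ n * p).coeff i =
      SkewMonoidAlgebra.coeff (SkewMonoidAlgebra.single (Multiplicative.ofAdd n) a *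
        (show SkewMonoidAlgebra L (Multiplicative ℕ) from p)) (Multiplicative.ofAdd i) := by
    rw [h1]; rfl
  rw [h2]
  split_ifs with h
  · exact SkewMonoidAlgebra.coeff_single_mul_aux _ (z := Multiplicative.ofAdd (i - n)) fun b =>
      ⟨fun hb => by
        have : n + b.toAdd = i := congrArg Multiplicative.toAdd hb
        rw [← ofAdd_toAdd b]; congr 1; omega,
      fun hb => by
        rw [hb, ← ofAdd_add]; congr 1; omega⟩
  · refine SkewMonoidAlgebra.coeff_single_mul_of_not_exists_mul _ _ ?_
    rintro ⟨d, hd⟩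
    have : i = n + d.toAdd := congrArg Multiplicative.toAdd hd
    omega

theorem X_mul_C (a : L) : X σ * C σ a = C σ (σ a) * X σ := by
  let _ := powAction σ
  have h := SkewPolynomial.monomial_mul_C (R := L) (n := 1) (a := 1) (b := a)
  have h2 := SkewPolynomial.monomial_mul_X (R := L) 0 (σ a)
  rw [one_mul] at h
  exact h.trans h2.symm

theorem C_algebraMap_mul (c : K) (p : TwistedPoly σ) :
    C σ (algebraMap K L c) * p = p * C σ (algebraMap K L c) := by
  let _ := powAction σ
  have : SMulCommClass (Multiplicative ℕ) K L :=
    ⟨fun n c a => map_smul (powersHom (L ≃ₐ[K] L) σ n) c a⟩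
  exact Algebra.commutes (A := SkewMonoidAlgebra L (Multiplicative ℕ)) c p

instance instAlgebra : Algebra K (TwistedPoly σ) :=
  ((C σ).comp (algebraMap K L)).toAlgebra' C_algebraMap_mul

theorem algebraMap_eq_C (c : K) : algebraMap K (TwistedPoly σ) c = C σ (algebraMap K L c) := rfl

@[ext] theorem ext {p q : TwistedPoly σ} (h : ∀ i, p.coeff i = q.coeff i) : p = q :=
  SkewMonoidAlgebra.ext fun i => h i.toAdd

@[simp] theorem coeff_zero (i : ℕ) : (0 : TwistedPoly σ).coeff i = 0 := rfl

@[simp] theorem coeff_add (p q : TwistedPoly σ) (i : ℕ) :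
    (p + q).coeff i = p.coeff i + q.coeff i :=
  SkewPolynomial.coeff_add p q i

theorem coeff_eq_zero_of_natDegree_lt {p : TwistedPoly σ} {i : ℕ} (h : p.natDegree < i) :
    p.coeff i = 0 := by
  by_contra hi
  exact absurd (Finset.le_sup (f := id) (SkewPolynomial.mem_support_iff.2 hi)) (not_le.2 h)

@[simp] theorem coeff_neg (p : TwistedPoly σ) (i : ℕ) : (-p).coeff i = -p.coeff i :=
  SkewPolynomial.coeff_neg p i

@[simp] theorem coeff_sub (p q : TwistedPoly σ) (i : ℕ) :
    (p - q).coeff i = p.coeff i - q.coeff i := by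
  rw [sub_eq_add_neg, coeff_add, coeff_neg, sub_eq_add_neg]

theorem coeff_C_mul (a : L) (p : TwistedPoly σ) (i : ℕ) : (C σ a * p).coeff i = a * p.coeff i := by
  simpa using coeff_C_mul_X_pow_mul a 0 p i

@[simp] theorem coeff_smul (c : K) (p : TwistedPoly σ) (i : ℕ) :
    (c • p).coeff i = c • p.coeff i := by
  rw [Algebra.smul_def, algebraMap_eq_C, coeff_C_mul, Algebra.smul_def]

/-- Every polynomial is the sum of its monomials. -/
theorem eq_sum (p : TwistedPoly σ) :
    p = ∑ i ∈ SkewPolynomial.support p, C σ (p.coeff i) * X σ ^ i := by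
  let _ := powAction σ
  have h := (SkewPolynomial.sum_monomial (R := L) p).symm
  refine (h.trans (SkewPolynomial.sum_def _ _)).trans (Finset.sum_congr rfl fun i _ => ?_)
  have h1 := SkewPolynomial.monomial_mul_X_pow (R := L) 0 (p.coeff i) i
  rw [zero_add] at h1
  exact h1.symm

theorem coeff_mul (g f : TwistedPoly σ) (i : ℕ) :
    (g * f).coeff i = ∑ j ∈ SkewPolynomial.support g,
      if j ≤ i then g.coeff j * (σ ^ j) (f.coeff (i - j)) else 0 := by
  have hsum : ∀ (s : Finset ℕ) (G : ℕ → TwistedPoly σ),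
      (∑ j ∈ s, G j).coeff i = ∑ j ∈ s, (G j).coeff i := fun s G =>
    map_sum (⟨⟨fun p : TwistedPoly σ => p.coeff i, coeff_zero i⟩,
      fun p q => coeff_add p q i⟩ : TwistedPoly σ →+ L) G s
  conv_lhs => rw [eq_sum g, Finset.sum_mul, hsum]
  exact Finset.sum_congr rfl fun j _ => coeff_C_mul_X_pow_mul _ _ _ _

theorem X_pow_mul_C (n : ℕ) (a : L) : X σ ^ n * C σ a = C σ ((σ ^ n) a) * X σ ^ n := by
  induction n with
  | zero => simp
  | succ n ih =>
    rw [pow_succ', mul_assoc, ih, ← mul_assoc, X_mul_C, mul_assoc, pow_succ' σ]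
    rfl

variable (σ) in
/-- The element `G(x ^ n)` of `R`, for `G ∈ K[y]` and `n = [L : K]`. -/
def central (G : K[X]) : TwistedPoly σ :=
  aeval (X σ ^ Module.finrank K L) G

theorem central_commute [FiniteDimensional K L] [IsGalois K L] (G : K[X]) (p : TwistedPoly σ) :
    central σ G * p = p * central σ G := by
  have hσ : σ ^ Module.finrank K L = 1 := by
    rw [← IsGalois.card_aut_eq_finrank K L]
    exact pow_card_eq_one'
  have h1 : ∀ q : TwistedPoly σ, Commute q (X σ ^ Module.finrank K L) := by
    intro q
    rw [eq_sum q]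
    refine Commute.sum_left _ _ _ fun i _ => Commute.mul_left ?_ ?_
    · change _ * _ = _ * _
      rw [X_pow_mul_C, hσ]; rfl
    · exact Commute.pow_pow (Commute.refl _) _ _
  change Commute _ _
  unfold central
  rw [aeval_eq_sum_range]
  refine Commute.sum_left _ _ _ fun i _ => Commute.smul_left ?_ _
  exact ((h1 p).pow_right i).symm

instance [FiniteDimensional K L] [IsGalois K L] (G : K[X]) :
    (Ideal.span {central σ G}).IsTwoSided where
  mul_mem_of_left {a} b ha := by
    obtain ⟨c, rfl⟩ := Ideal.mem_span_singleton'.1 ha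
    rw [mul_assoc, central_commute, ← mul_assoc]
    exact Ideal.mul_mem_left _ _ (Ideal.mem_span_singleton_self _)

variable (σ) in
/-- The ring `R_F = R / R F(x ^ n)`. -/
abbrev QuotientRing (F : K[X]) : Type _ := TwistedPoly σ ⧸ Ideal.span {central σ F}

/-- The left `R`-module `R / R f`. -/
abbrev QuotientModule (f : TwistedPoly σ) : Type _ := TwistedPoly σ ⧸ Ideal.span {f}

/-- The element `p` of `R` is a product of `m` irreducible elements of `R`. -/
def IsProductOfIrreducibles (p : TwistedPoly σ) (m : ℕ) : Prop :=
  ∃ l : List (TwistedPoly σ), l.length = m ∧ (∀ q ∈ l, Irreducible q) ∧ l.prod = p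

variable (σ) in
/-- The polynomials of degree less than `d`. -/
def degreeLT (d : ℕ) : Submodule K (TwistedPoly σ) where
  carrier := {p | ∀ i, d ≤ i → p.coeff i = 0}
  add_mem' hp hq i hi := by rw [coeff_add, hp i hi, hq i hi, add_zero]
  zero_mem' _ _ := rfl
  smul_mem' c p hp i hi := by rw [coeff_smul, hp i hi, smul_zero]

theorem mem_degreeLT {d : ℕ} {p : TwistedPoly σ} :
    p ∈ degreeLT σ d ↔ ∀ i, d ≤ i → p.coeff i = 0 := Iff.rfl

/-- Right division by a monic polynomial: existence of the remainder. -/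
theorem exists_remainder {f : TwistedPoly σ} (hf : f.Monic) (p : TwistedPoly σ) :
    ∃ r ∈ degreeLT σ f.natDegree, p - r ∈ Ideal.span {f} := by
  have key : ∀ N : ℕ, ∀ p : TwistedPoly σ, p ∈ degreeLT σ (f.natDegree + N) →
      ∃ r ∈ degreeLT σ f.natDegree, p - r ∈ Ideal.span {f} := by
    intro N
    induction N with
    | zero => exact fun p hp => ⟨p, hp, by simp⟩
    | succ N ih =>
      intro p hp
      set g := C σ (p.coeff (f.natDegree + N)) * X σ ^ N with hg
      obtain ⟨r, hr, hpr⟩ := ih (p - g * f) (by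
        intro i hi
        rw [coeff_sub, hg, coeff_C_mul_X_pow_mul, if_pos (by omega)]
        rcases hi.eq_or_lt with rfl | hi
        · rw [Nat.add_sub_cancel, show f.coeff f.natDegree = 1 from hf, map_one, mul_one, sub_self]
        · rw [hp i (by omega), coeff_eq_zero_of_natDegree_lt (p := f) (by omega), map_zero,
            mul_zero, sub_zero])
      refine ⟨r, hr, ?_⟩
      have := add_mem hpr (Ideal.mul_mem_left _ g (Ideal.mem_span_singleton_self f))
      rwa [show p - g * f - r + g * f = p - r by abel] at this
  refine key (p.natDegree + 1) p fun i hi => coeff_eq_zero_of_natDegree_lt (by omega)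

/-- Right division by a monic polynomial: uniqueness of the remainder. -/
theorem eq_zero_of_mem_span {f : TwistedPoly σ} (hf : f.Monic) {r : TwistedPoly σ}
    (hr : r ∈ degreeLT σ f.natDegree) (hrf : r ∈ Ideal.span {f}) : r = 0 := by
  obtain ⟨g, rfl⟩ := Ideal.mem_span_singleton'.1 hrf
  by_contra hne
  have hg : (SkewPolynomial.support g).Nonempty := by
    rw [Finset.nonempty_iff_ne_empty]
    intro h
    exact hne (by rw [SkewPolynomial.support_eq_empty.1 h]; exact zero_mul f)
  obtain ⟨e, he, hmax⟩ := (SkewPolynomial.support g).exists_max_image id hg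
  have h0 := hr (f.natDegree + e) (by omega)
  rw [coeff_mul, Finset.sum_eq_single_of_mem e he] at h0
  · rw [if_pos (by omega), Nat.add_sub_cancel, show f.coeff f.natDegree = 1 from hf, map_one,
      mul_one] at h0
    exact SkewPolynomial.mem_support_iff.1 he h0
  · intro j hj hje
    have hj' : j < e := lt_of_le_of_ne (hmax j hj) hje
    rw [if_pos (by omega), coeff_eq_zero_of_natDegree_lt (p := f) (by omega), map_zero, mul_zero]

/-- The elements of `R / R f` are represented, uniquely, by the polynomials of degree less
than `deg f`. -/
def remainderEquiv {f : TwistedPoly σ} (hf : f.Monic) :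
    degreeLT σ f.natDegree ≃ₗ[K] QuotientModule f :=
  LinearEquiv.ofBijective
    (((Ideal.span {f}).mkQ.restrictScalars K).comp (degreeLT σ f.natDegree).subtype) <| by
    constructor
    · rw [← LinearMap.ker_eq_bot, LinearMap.ker_eq_bot']
      intro r hr
      exact Subtype.ext (eq_zero_of_mem_span hf r.2 ((Submodule.Quotient.mk_eq_zero _).1 hr))
    · intro u
      obtain ⟨p, rfl⟩ := (Ideal.span {f}).mkQ_surjective u
      obtain ⟨r, hr, hpr⟩ := exists_remainder hf p
      exact ⟨⟨r, hr⟩, ((Submodule.Quotient.eq _).2 hpr).symm⟩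

/-- The representative of degree less than `deg f` of a class in `R / R f`. -/
def remainder {f : TwistedPoly σ} (hf : f.Monic) : QuotientModule f →ₗ[K] TwistedPoly σ :=
  (degreeLT σ f.natDegree).subtype.comp (remainderEquiv hf).symm.toLinearMap

theorem remainder_mk {f : TwistedPoly σ} (hf : f.Monic) {r : TwistedPoly σ}
    (hr : r ∈ degreeLT σ f.natDegree) :
    remainder hf ((Ideal.span {f}).mkQ r) = r :=
  congrArg Subtype.val ((remainderEquiv hf).symm_apply_apply ⟨r, hr⟩)

end TwistedPoly

/-! ### The codes and the algebras -/

variable (K) in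
/-- The field `K' = Fix(ρ) ∩ K`. -/
def fixedBase (ρ : L ≃+* L) : Subfield K where
  carrier := {c | ρ (algebraMap K L c) = algebraMap K L c}
  mul_mem' ha hb := by simp only [Set.mem_ofPred_eq, map_mul] at *; rw [ha, hb]
  one_mem' := by simp
  add_mem' ha hb := by simp only [Set.mem_ofPred_eq, map_add] at *; rw [ha, hb]
  zero_mem' := by simp
  neg_mem' ha := by simp only [Set.mem_ofPred_eq, map_neg] at *; rw [ha]
  inv_mem' a ha := by simp only [Set.mem_ofPred_eq, map_inv₀] at *; rw [ha]

variable (K) in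
/-- The automorphism `ρ` of `L`, regarded as an automorphism over `K'`. -/
def overBase (ρ : L ≃+* L) : L ≃ₐ[fixedBase K ρ] L :=
  AlgEquiv.ofRingEquiv (f := ρ) fun c => c.2

/-- The fixed field `{a | ψ(a) = a}` of an automorphism `ψ` of `L`, as an algebra over a field
of constants `k`. -/
def fixedElements {k : Type*} [Field k] [Algebra k L] (ψ : L ≃ₐ[k] L) : Subalgebra k L :=
  AlgHom.equalizer (ψ : L →ₐ[k] L) (AlgHom.id k L)

namespace TwistedPoly

variable {σ : L ≃ₐ[K] L}

variable (σ) in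
/-- The polynomials `a₀ + a₁ x + ⋯ + a_{d-1} x ^ (d-1) + η ρ(a₀) x ^ d` (for `d ≥ 1`). -/
def twistedPolys (ρ : L ≃+* L) (η : L) (d : ℕ) : Submodule (fixedBase K ρ) (TwistedPoly σ) where
  carrier := {p | (∀ i, d < i → p.coeff i = 0) ∧ p.coeff d = η * ρ (p.coeff 0)}
  add_mem' hp hq := ⟨fun i hi => by rw [coeff_add, hp.1 i hi, hq.1 i hi, add_zero], by
    rw [coeff_add, coeff_add, hp.2, hq.2, map_add, mul_add]⟩
  zero_mem' := ⟨fun _ _ => rfl, by simp⟩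
  smul_mem' c p hp := ⟨fun i hi => by
      rw [Subfield.smul_def, coeff_smul, hp.1 i hi, smul_zero], by
    have hc : ρ (algebraMap K L c) = algebraMap K L c := c.2
    rw [Subfield.smul_def, coeff_smul, coeff_smul, hp.2, Algebra.smul_def, Algebra.smul_def,
      map_mul, hc]
    ring⟩

variable (σ) in
/-- The code `S_{n, d', k}(η, ρ, F)` with `d = k d'`: the classes in `R / R F(x ^ n)` of the
polynomials `a₀ + a₁ x + ⋯ + a_{d-1} x ^ (d-1) + η ρ(a₀) x ^ d`. -/
def twistedCode [FiniteDimensional K L] [IsGalois K L] (ρ : L ≃+* L) (η : L) (F : K[X]) (d : ℕ) :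
    Submodule (fixedBase K ρ) (QuotientRing σ F) :=
  (twistedPolys σ ρ η d).map
    (Ideal.Quotient.mkₐ (fixedBase K ρ) (Ideal.span {central σ F})).toLinearMap

variable (K) in
/-- The map `τ : y ↦ y - η ρ(y) f₀`. -/
def tau (ρ : L ≃+* L) (η f₀ : L) : L →ₗ[fixedBase K ρ] L :=
  LinearMap.id - (LinearMap.mulLeft _ (η * f₀)).comp (overBase K ρ).toLinearMap

theorem tau_apply (ρ : L ≃+* L) (η f₀ y : L) : tau K ρ η f₀ y = y - η * ρ y * f₀ := by
  change y - η * f₀ * ρ y = _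
  ring

theorem tau_injective [FiniteDimensional K L] (ρ : L ≃+* L) [FiniteDimensional (fixedBase K ρ) K]
    (η f₀ : L)
    (h : Algebra.norm (fixedBase K ρ) (η * f₀) ≠ 1) : Function.Injective (tau K ρ η f₀) := by
  have : FiniteDimensional (fixedBase K ρ) L := FiniteDimensional.trans _ K L
  rw [← LinearMap.ker_eq_bot, LinearMap.ker_eq_bot']
  intro b hb
  rw [tau_apply] at hb
  by_contra hb0
  have h1 : η * f₀ * overBase K ρ b = b := by
    change η * f₀ * ρ b = b
    linear_combination -hb
  have h2 := congrArg (Algebra.norm (fixedBase K ρ)) h1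
  rw [map_mul, Algebra.norm_eq_of_algEquiv] at h2
  exact h (mul_right_cancel₀ (Algebra.norm_ne_zero_iff.2 hb0) (h2.trans (one_mul _).symm))

/-- The map `τ` as a bijection. -/
def tauEquiv [FiniteDimensional K L] (ρ : L ≃+* L) [FiniteDimensional (fixedBase K ρ) K]
    (η f₀ : L) (h : Algebra.norm (fixedBase K ρ) (η * f₀) ≠ 1) : L ≃ₗ[fixedBase K ρ] L :=
  haveI : FiniteDimensional (fixedBase K ρ) L := FiniteDimensional.trans _ K L
  LinearEquiv.ofInjectiveEndo (tau K ρ η f₀) (tau_injective ρ η f₀ h)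

section Algebra

variable [FiniteDimensional K L] (ρ : L ≃+* L) [FiniteDimensional (fixedBase K ρ) K]
  {f : TwistedPoly σ} (hf : f.Monic) {η : L}
  (hη : Algebra.norm (fixedBase K ρ) (η * f.coeff 0) ≠ 1)

/-- The map sending the class of `r = (a₀ - η ρ(a₀) f₀) + a₁ x + ⋯ + a_{d-1} x ^ (d-1)`, where
`d = deg f`, to the polynomial `r + η ρ(a₀) f`. -/
def spreadMap : QuotientModule f →ₗ[fixedBase K ρ] TwistedPoly σ where
  toFun u := remainder hf u +
    C σ (η * ρ ((tauEquiv ρ η (f.coeff 0) hη).symm ((remainder hf u).coeff 0))) * f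
  map_add' u v := by
    simp only [map_add, coeff_add, mul_add, add_mul]
    abel
  map_smul' c u := by
    have hc : ρ (algebraMap K L c) = algebraMap K L c := c.2
    have h1 : remainder hf (c • u) = c • remainder hf u := (remainder hf).map_smul (c : K) u
    have h2 : (c • remainder hf u).coeff 0 = c • (remainder hf u).coeff 0 :=
      coeff_smul (c : K) (remainder hf u) 0
    have h3 : ∀ (a : L), C σ (c • a) = c • C σ a := fun a => by
      rw [Subfield.smul_def, Subfield.smul_def, Algebra.smul_def, Algebra.smul_def, map_mul,
        algebraMap_eq_C]
    have h4 : ∀ a : L, ρ (c • a) = c • ρ a := fun a => by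
      rw [Subfield.smul_def, Subfield.smul_def, Algebra.smul_def, Algebra.smul_def, map_mul, hc]
    rw [h1, h2, map_smul, h4, mul_smul_comm, h3, smul_mul_assoc, RingHom.id_apply, smul_add]

/-- The formula that describes `spreadMap`. -/
theorem spreadMap_apply (a₀ : L) {r : TwistedPoly σ} (hr : r ∈ degreeLT σ f.natDegree)
    (hr₀ : r.coeff 0 = a₀ - η * ρ a₀ * f.coeff 0) :
    spreadMap ρ hf hη ((Ideal.span {f}).mkQ r) = r + C σ (η * ρ a₀) * f := by
  change remainder hf ((Ideal.span {f}).mkQ r) + C σ (η * ρ ((tauEquiv ρ η (f.coeff 0) hη).symm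
    ((remainder hf ((Ideal.span {f}).mkQ r)).coeff 0))) * f = _
  rw [remainder_mk hf hr, hr₀, ← tau_apply (K := K)]
  congr 4
  exact congrArg ρ ((tauEquiv ρ η (f.coeff 0) hη).symm_apply_apply a₀)

/-- The `K'`-bilinear multiplication on `R / R f` given by
`a ⋆ b = (r + η ρ(a₀) f) z(x ^ n) x ^ (s n - 1) b` if `a` is the class of the polynomial
`r = (a₀ - η ρ(a₀) f₀) + a₁ x + ⋯ + a_{d-1} x ^ (d-1)` of degree less than `d = deg f`. -/
def starMul (z : K[X]) (s : ℕ) :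
    QuotientModule f →ₗ[fixedBase K ρ] QuotientModule f →ₗ[fixedBase K ρ] QuotientModule f :=
  LinearMap.mk₂ _
    (fun a b => (spreadMap ρ hf hη a * (central σ z * X σ ^ (s * Module.finrank K L - 1))) • b)
    (fun a a' b => by rw [map_add, add_mul, add_smul])
    (fun c a b => by rw [map_smul, smul_mul_assoc, smul_assoc])
    (fun a b b' => smul_add _ _ _)
    (fun c a b => by
      rw [← algebraMap_smul (TwistedPoly σ) c b, ← algebraMap_smul (TwistedPoly σ) c (_ • b),
        ← mul_smul, ← mul_smul, Algebra.commutes])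

/-- The `K'`-algebra `(R / R f, ⋆)`, with the multiplication `starMul`. -/
def TwistedAlgebra (_hf : f.Monic) (_hη : Algebra.norm (fixedBase K ρ) (η * f.coeff 0) ≠ 1)
    (_z : K[X]) (_s : ℕ) : Type _ :=
  QuotientModule f

namespace TwistedAlgebra

variable (z : K[X]) (s : ℕ)

instance : AddCommGroup (TwistedAlgebra ρ hf hη z s) :=
  inferInstanceAs (AddCommGroup (QuotientModule f))

instance : Module (fixedBase K ρ) (TwistedAlgebra ρ hf hη z s) :=
  inferInstanceAs (Module (fixedBase K ρ) (QuotientModule f))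

/-- The underlying vector space of the algebra is `R / R f`. -/
def ofQuotient : QuotientModule f ≃ₗ[fixedBase K ρ] TwistedAlgebra ρ hf hη z s :=
  LinearEquiv.refl _ (QuotientModule f)

/-- The class of a polynomial, as an element of the algebra. -/
def mk (p : TwistedPoly σ) : TwistedAlgebra ρ hf hη z s :=
  ofQuotient ρ hf hη z s ((Ideal.span {f}).mkQ p)

instance : Mul (TwistedAlgebra ρ hf hη z s) where
  mul a b := ofQuotient ρ hf hη z s (starMul ρ hf hη z s
    ((ofQuotient ρ hf hη z s).symm a) ((ofQuotient ρ hf hη z s).symm b))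

theorem mul_def (a b : TwistedAlgebra ρ hf hη z s) :
    a * b = ofQuotient ρ hf hη z s (starMul ρ hf hη z s
      ((ofQuotient ρ hf hη z s).symm a) ((ofQuotient ρ hf hη z s).symm b)) := rfl

instance : NonUnitalNonAssocRing (TwistedAlgebra ρ hf hη z s) where
  left_distrib a b c := by simp only [mul_def, map_add]
  right_distrib a b c := by simp only [mul_def, map_add, LinearMap.add_apply]
  zero_mul b := by simp only [mul_def, map_zero, LinearMap.zero_apply]
  mul_zero a := by simp only [mul_def, map_zero]

instance : IsScalarTower (fixedBase K ρ) (TwistedAlgebra ρ hf hη z s)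
    (TwistedAlgebra ρ hf hη z s) where
  smul_assoc c a b := by
    simp only [smul_eq_mul, mul_def, map_smul, LinearMap.smul_apply]

instance : SMulCommClass (fixedBase K ρ) (TwistedAlgebra ρ hf hη z s)
    (TwistedAlgebra ρ hf hη z s) where
  smul_comm c a b := by
    simp only [smul_eq_mul, mul_def, map_smul]

/-- The defining formula of the multiplication. -/
theorem mk_mul_mk (a₀ : L) {r : TwistedPoly σ} (hr : r ∈ degreeLT σ f.natDegree)
    (hr₀ : r.coeff 0 = a₀ - η * ρ a₀ * f.coeff 0) (b : TwistedPoly σ) :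
    mk ρ hf hη z s r * mk ρ hf hη z s b = mk ρ hf hη z s
      ((r + C σ (η * ρ a₀) * f) * (central σ z * X σ ^ (s * Module.finrank K L - 1)) * b) := by
  change ofQuotient ρ hf hη z s
    ((spreadMap ρ hf hη ((Ideal.span {f}).mkQ r) * _) • (Ideal.span {f}).mkQ b) =
    ofQuotient ρ hf hη z s ((Ideal.span {f}).mkQ _)
  rw [spreadMap_apply ρ hf hη a₀ hr hr₀, ← map_smul, smul_eq_mul]

end TwistedAlgebra

end Algebra

end TwistedPoly

end SkewPolynomialRing

end

/-! Two facts about the quotient by `F(x ^ n)` carry the whole proof. Since `F(0) ≠ 0`, the class of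
`x` is a unit (`exists_inv_X`). The quotient is also a simple ring
(`eq_span_central_of_isTwoSided`), so the nonzero module `R / R f` is faithful over it: polynomials
that act equally on `R / R f` are congruent modulo `F(x ^ n)` (`mem_span_central_of_annihilates`).

Codes. Put `d = s k ℓ`. The bound `2 k ≤ m` gives `2 d ≤ s n`, so the products used as tests have
degree below `s n` and are their own remainders. Multiplying the words `x`, `x ^ 2` and `x ^ (d -
1)` (or `1` in place of the first two when `η = 0`) forces every element of an idealiser to be a
constant. For `η ≠ 0` the single word `1 + η x ^ d` then gives the equation that the constant
satisfies. An element of the centraliser commutes with `x` and with all `a x`, hence with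
everything.

Degrees. Every irreducible factor `q` of `F(x ^ n)` has `R / R q ≅ R / R f`, so all factors have the
same degree and `m deg f = s n`. The characteristic polynomial of `x ^ n` acting on `R / R f` has
coefficients in `K` and only roots of `F` as roots, so `s ∣ deg f`. Together these give `deg f = s
ℓ`.

Algebras. The polynomials `r + η ρ(a₀) f` are exactly the polynomials defining the code with `k =
1`, and `z(x ^ n) x ^ (s n - 1)` acts as the inverse of `x`. Thus `a ⋆ b = A x⁻¹ b`, where `A` is
the word that represents `a` (`mul_eq`, `spread_mk`). If a nonzero `A` kills a nonzero class, then
`A` is a constant times a monic polynomial similar to `f`. Similar monic polynomials have constant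
coefficients of equal norm (`norm_coeff_zero_eq`), and the shape of `A` then forces `N(η f₀) = 1`,
which is excluded. By faithfulness, left and middle nuclear elements give elements `A x⁻¹` and `x⁻¹
A` of the left and right idealisers of the `k = 1` code. Right multiplication by an element of the
right nucleus commutes with the constants and with `x`, so it is an `R`-endomorphism of `R / R f`,
that is, an element of the eigenring. -/

noncomputable section

namespace TwistedPoly

/-! ### Coefficients and degrees of twisted polynomials -/

section Basic

variable {K L : Type*} [Field K] [Field L] [Algebra K L] {σ : L ≃ₐ[K] L}

theorem coeff_one (i : ℕ) : (1 : TwistedPoly σ).coeff i = if i = 0 then 1 else 0 :=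
  letI := powAction σ
  SkewPolynomial.coeff_C (a := (1 : L))

theorem coeff_C_mul_X_pow (a : L) (n i : ℕ) :
    (C σ a * X σ ^ n).coeff i = if i = n then a else 0 := by
  have h := coeff_C_mul_X_pow_mul a n (1 : TwistedPoly σ) i
  rw [mul_one, coeff_one] at h
  rw [h]
  split_ifs <;> first | omega | simp

theorem coeff_C (a : L) (i : ℕ) : (C σ a).coeff i = if i = 0 then a else 0 := by
  simpa using coeff_C_mul_X_pow a 0 (σ := σ) i

theorem coeff_X_pow (n i : ℕ) : (X σ ^ n).coeff i = if i = n then 1 else 0 := by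
  simpa using coeff_C_mul_X_pow (σ := σ) 1 n i

theorem coeff_X (i : ℕ) : (X σ).coeff i = if i = 1 then 1 else 0 := by
  simpa using coeff_X_pow (σ := σ) 1 i

theorem coeff_X_pow_mul (n : ℕ) (p : TwistedPoly σ) (i : ℕ) :
    (X σ ^ n * p).coeff i = if n ≤ i then (σ ^ n) (p.coeff (i - n)) else 0 := by
  simpa using coeff_C_mul_X_pow_mul 1 n p i

theorem coeff_X_mul_succ (p : TwistedPoly σ) (i : ℕ) :
    (X σ * p).coeff (i + 1) = σ (p.coeff i) := by
  simpa using coeff_X_pow_mul 1 p (i + 1)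

theorem coeff_X_mul_zero (p : TwistedPoly σ) : (X σ * p).coeff 0 = 0 := by
  simpa using coeff_X_pow_mul 1 p 0

theorem coeff_mul_X_pow (p : TwistedPoly σ) (n i : ℕ) :
    (p * X σ ^ n).coeff i = if n ≤ i then p.coeff (i - n) else 0 := by
  rw [coeff_mul]
  split_ifs with h
  · rw [Finset.sum_eq_single (i - n)]
    · rw [if_pos (Nat.sub_le _ _), coeff_X_pow, if_pos (by omega), map_one, mul_one]
    · intro j _ hj
      split_ifs with hji
      · rw [coeff_X_pow, if_neg (by omega), map_zero, mul_zero]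
      · rfl
    · intro hi
      rw [show p.coeff (i - n) = 0 from SkewPolynomial.notMem_support_iff.1 hi]
      simp
  · refine Finset.sum_eq_zero fun j _ => ?_
    split_ifs with hji
    · rw [coeff_X_pow, if_neg (by omega), map_zero, mul_zero]
    · rfl

theorem coeff_mul_X_succ (p : TwistedPoly σ) (i : ℕ) :
    (p * X σ).coeff (i + 1) = p.coeff i := by
  simpa using coeff_mul_X_pow p 1 (i + 1)

theorem coeff_mul_X_zero (p : TwistedPoly σ) : (p * X σ).coeff 0 = 0 := by
  simpa using coeff_mul_X_pow p 1 0

theorem coeff_mul_C (p : TwistedPoly σ) (a : L) (i : ℕ) :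
    (p * C σ a).coeff i = p.coeff i * (σ ^ i) a := by
  rw [coeff_mul, Finset.sum_eq_single i]
  · rw [if_pos le_rfl, Nat.sub_self, coeff_C, if_pos rfl]
  · intro j _ hj
    split_ifs with hji
    · rw [coeff_C, if_neg (by omega), map_zero, mul_zero]
    · rfl
  · intro hi
    rw [show p.coeff i = 0 from SkewPolynomial.notMem_support_iff.1 hi]
    simp

theorem C_injective : Function.Injective (C σ) := fun a b h => by
  simpa [coeff_C] using congrArg (coeff · 0) h

theorem coeff_sum {ι : Type*} (s : Finset ι) (g : ι → TwistedPoly σ) (i : ℕ) :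
    (∑ j ∈ s, g j).coeff i = ∑ j ∈ s, (g j).coeff i :=
  map_sum (⟨⟨fun p : TwistedPoly σ => p.coeff i, coeff_zero i⟩,
    fun p q => coeff_add p q i⟩ : TwistedPoly σ →+ L) g s

instance : Nontrivial (TwistedPoly σ) :=
  ⟨0, 1, fun h => by simpa [coeff_one] using congrArg (coeff · 0) h⟩

theorem X_ne_zero : X σ ≠ 0 := fun h => by
  simpa [coeff_X] using congrArg (coeff · 1) h

theorem mem_degreeLT_natDegree (p : TwistedPoly σ) : p ∈ degreeLT σ (p.natDegree + 1) :=
  fun _ hi => coeff_eq_zero_of_natDegree_lt hi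

theorem coeff_natDegree_ne_zero {p : TwistedPoly σ} (hp : p ≠ 0) : p.coeff p.natDegree ≠ 0 := by
  have hne : (SkewPolynomial.support p).Nonempty := by
    rw [Finset.nonempty_iff_ne_empty]
    exact fun h => hp (SkewPolynomial.support_eq_empty.1 h)
  obtain ⟨e, he, h⟩ := Finset.exists_mem_eq_sup _ hne id
  rw [natDegree, h]
  exact SkewPolynomial.mem_support_iff.1 he

theorem natDegree_lt_of_mem {p : TwistedPoly σ} (hp : p ≠ 0) {d : ℕ} (h : p ∈ degreeLT σ d) :
    p.natDegree < d := by
  by_contra hd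
  exact coeff_natDegree_ne_zero hp (h _ (not_lt.1 hd))

theorem natDegree_eq_of_mem {p : TwistedPoly σ} {d : ℕ} (h : p ∈ degreeLT σ (d + 1))
    (hd : p.coeff d ≠ 0) : p.natDegree = d := by
  refine le_antisymm (Nat.lt_succ_iff.1 (natDegree_lt_of_mem ?_ h)) ?_
  · rintro rfl
    exact hd rfl
  · by_contra hlt
    exact hd (coeff_eq_zero_of_natDegree_lt (not_le.1 hlt))

theorem mul_mem_degreeLT {p q : TwistedPoly σ} {a b : ℕ} (hp : p ∈ degreeLT σ (a + 1))
    (hq : q ∈ degreeLT σ (b + 1)) : p * q ∈ degreeLT σ (a + b + 1) := by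
  intro i hi
  rw [coeff_mul]
  refine Finset.sum_eq_zero fun j hj => ?_
  have hja : j ≤ a := by
    by_contra h
    exact SkewPolynomial.mem_support_iff.1 hj (hp j (by omega))
  split_ifs
  · rw [hq _ (by omega), map_zero, mul_zero]
  · rfl

theorem coeff_mul_add {p q : TwistedPoly σ} {a b : ℕ} (hp : p ∈ degreeLT σ (a + 1))
    (hq : q ∈ degreeLT σ (b + 1)) : (p * q).coeff (a + b) = p.coeff a * (σ ^ a) (q.coeff b) := by
  rw [coeff_mul, Finset.sum_eq_single a]
  · rw [if_pos (by omega), Nat.add_sub_cancel_left]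
  · intro j hj hja
    have hj' : j ≤ a := by
      by_contra h
      exact SkewPolynomial.mem_support_iff.1 hj (hp j (by omega))
    split_ifs
    · rw [hq _ (by omega), map_zero, mul_zero]
    · rfl
  · intro h
    rw [show p.coeff a = 0 from SkewPolynomial.notMem_support_iff.1 h]
    simp

instance : NoZeroDivisors (TwistedPoly σ) where
  eq_zero_or_eq_zero_of_mul_eq_zero {p q} h := by
    by_contra! hpq
    have h1 := coeff_mul_add (mem_degreeLT_natDegree p) (mem_degreeLT_natDegree q)
    rw [h, coeff_zero, eq_comm, mul_eq_zero, EmbeddingLike.map_eq_zero_iff] at h1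
    exact h1.elim (coeff_natDegree_ne_zero hpq.1) (coeff_natDegree_ne_zero hpq.2)

instance : IsDomain (TwistedPoly σ) := NoZeroDivisors.to_isDomain _

theorem natDegree_mul {p q : TwistedPoly σ} (hp : p ≠ 0) (hq : q ≠ 0) :
    (p * q).natDegree = p.natDegree + q.natDegree := by
  refine natDegree_eq_of_mem (mul_mem_degreeLT (mem_degreeLT_natDegree p)
    (mem_degreeLT_natDegree q)) ?_
  rw [coeff_mul_add (mem_degreeLT_natDegree p) (mem_degreeLT_natDegree q)]
  exact mul_ne_zero (coeff_natDegree_ne_zero hp)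
    ((_root_.map_ne_zero _).2 (coeff_natDegree_ne_zero hq))

theorem eq_C_of_mem_degreeLT {p : TwistedPoly σ} (h : p ∈ degreeLT σ 1) :
    p = C σ (p.coeff 0) := by
  ext i
  rw [coeff_C]
  split_ifs with hi
  · rw [hi]
  · exact h i (by omega)

theorem natDegree_zero : (0 : TwistedPoly σ).natDegree = 0 :=
  congrArg (Finset.sup · id) (SkewPolynomial.support_zero (R := L))

theorem natDegree_C (a : L) : (C σ a).natDegree = 0 := by
  by_contra h
  have h0 : C σ a ≠ 0 := by
    intro h0
    rw [h0] at h
    exact h natDegree_zero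
  have := coeff_natDegree_ne_zero h0
  rw [coeff_C, if_neg h] at this
  exact this rfl

theorem isUnit_C {a : L} (ha : a ≠ 0) : IsUnit (C σ a) := (IsUnit.mk0 a ha).map (C σ)

theorem isUnit_iff {p : TwistedPoly σ} : IsUnit p ↔ p ≠ 0 ∧ p.natDegree = 0 := by
  constructor
  · intro h
    obtain ⟨q, hq⟩ := h.exists_right_inv
    have h0 := h.ne_zero
    have hq0 : q ≠ 0 := by
      rintro rfl
      simp at hq
    have h1 := natDegree_mul h0 hq0
    rw [hq, ← map_one (C σ), natDegree_C] at h1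
    exact ⟨h0, by omega⟩
  · rintro ⟨h0, hd⟩
    have h1 := mem_degreeLT_natDegree p
    rw [hd] at h1
    rw [eq_C_of_mem_degreeLT h1]
    refine isUnit_C ?_
    have := coeff_natDegree_ne_zero h0
    rwa [hd] at this

theorem Monic.ne_zero {p : TwistedPoly σ} (h : p.Monic) : p ≠ 0 := by
  rintro rfl
  exact zero_ne_one h

/-- Every nonzero polynomial is a constant multiple of a monic one. -/
theorem exists_monic {p : TwistedPoly σ} (hp : p ≠ 0) :
    ∃ q : TwistedPoly σ, q.Monic ∧ q.natDegree = p.natDegree ∧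
      p = C σ (p.coeff p.natDegree) * q := by
  have h0 := coeff_natDegree_ne_zero hp
  set c := p.coeff p.natDegree
  have hq : (C σ c⁻¹ * p).coeff p.natDegree = 1 := by
    rw [coeff_C_mul, inv_mul_cancel₀ h0]
  have hd : (C σ c⁻¹ * p).natDegree = p.natDegree :=
    natDegree_eq_of_mem (fun i hi => by
      rw [coeff_C_mul, coeff_eq_zero_of_natDegree_lt (by omega), mul_zero]) (by rw [hq]; simp)
  refine ⟨C σ c⁻¹ * p, ?_, hd, ?_⟩
  · rw [Monic, hd, hq]
  · rw [← mul_assoc, ← map_mul, mul_inv_cancel₀ h0, map_one, one_mul]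

theorem span_C_mul {a : L} (ha : a ≠ 0) (q : TwistedPoly σ) :
    Ideal.span {C σ a * q} = Ideal.span {q} := by
  refine le_antisymm ?_ ?_ <;> rw [Ideal.span_singleton_le_iff_mem, Ideal.mem_span_singleton']
  · exact ⟨_, rfl⟩
  · exact ⟨C σ a⁻¹, by rw [← mul_assoc, ← map_mul, inv_mul_cancel₀ ha, map_one, one_mul]⟩

/-- Every left ideal of the twisted polynomial ring is principal. -/
theorem exists_eq_span_singleton (I : Ideal (TwistedPoly σ)) : ∃ g, I = Ideal.span {g} := by
  by_cases hI : I = ⊥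
  · exact ⟨0, by rw [hI, Ideal.span_singleton_zero]⟩
  have hex : ∃ e, ∃ p ∈ I, p ≠ 0 ∧ p.natDegree = e := by
    obtain ⟨p, hp, h0⟩ := Submodule.exists_mem_ne_zero_of_ne_bot hI
    exact ⟨_, p, hp, h0, rfl⟩
  classical
  obtain ⟨p, hp, h0, hpe⟩ := Nat.find_spec hex
  obtain ⟨q, hq, hqd, hpq⟩ := exists_monic h0
  have hspan : Ideal.span {p} = Ideal.span {q} := by
    rw [hpq, span_C_mul (coeff_natDegree_ne_zero h0)]
  refine ⟨p, le_antisymm (fun r hr => ?_) ((Ideal.span_singleton_le_iff_mem I).2 hp)⟩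
  obtain ⟨t, ht, hrt⟩ := exists_remainder hq r
  rw [hspan]
  by_cases ht0 : t = 0
  · rwa [ht0, sub_zero] at hrt
  · exfalso
    have hle : Ideal.span {q} ≤ I := hspan ▸ (Ideal.span_singleton_le_iff_mem I).2 hp
    have hti : t ∈ I := by
      have := I.sub_mem hr (hle hrt)
      rwa [sub_sub_cancel] at this
    have h1 := natDegree_lt_of_mem ht0 ht
    exact Nat.find_min hex (by omega) ⟨t, hti, ht0, rfl⟩

/-- If `f` is irreducible, then `R / R f` is a simple left module. -/
theorem isSimpleModule_quotient {f : TwistedPoly σ} (hf : Irreducible f) :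
    IsSimpleModule (TwistedPoly σ) (QuotientModule f) := by
  rw [isSimpleModule_iff_isCoatom]
  refine ⟨fun h => hf.not_isUnit ?_, fun I hI => ?_⟩
  · obtain ⟨g, hg⟩ := Ideal.mem_span_singleton'.1 (h ▸ Submodule.mem_top : (1 : TwistedPoly σ) ∈ _)
    exact IsUnit.of_mul_eq_one_right g hg
  · obtain ⟨g, rfl⟩ := exists_eq_span_singleton I
    obtain ⟨c, hc⟩ := Ideal.mem_span_singleton'.1 (hI.le (Ideal.mem_span_singleton_self f))
    rcases hf.isUnit_or_isUnit hc.symm with h | h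
    · exfalso
      refine hI.not_ge ?_
      rw [Ideal.span_singleton_le_iff_mem, Ideal.mem_span_singleton']
      obtain ⟨u, rfl⟩ := h
      exact ⟨↑u⁻¹, by rw [← hc, Units.inv_mul_cancel_left]⟩
    · obtain ⟨u, rfl⟩ := h
      exact Ideal.eq_top_of_isUnit_mem _ (Ideal.mem_span_singleton_self _) u.isUnit

end Basic

/-! ### Central polynomials and two-sided ideals -/

section Central

variable {K L : Type*} [Field K] [Field L] [Algebra K L] {σ : L ≃ₐ[K] L}

/-- Subtracting the multiple of `f` with the same top coefficient leaves a remainder that lies in `R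
f`, hence zero. This identifies the elements of `R f` of least degree. -/
theorem eq_C_mul_of_mem_span {f : TwistedPoly σ} (hf : f.Monic) {r : TwistedPoly σ}
    (hr : r ∈ degreeLT σ (f.natDegree + 1)) (hrf : r ∈ Ideal.span {f}) :
    r = C σ (r.coeff f.natDegree) * f := by
  rw [← sub_eq_zero]
  refine eq_zero_of_mem_span hf (fun i hi => ?_)
    (sub_mem hrf (Ideal.mul_mem_left _ _ (Ideal.mem_span_singleton_self f)))
  rw [coeff_sub, coeff_C_mul]
  rcases hi.eq_or_lt with rfl | hi
  · rw [show f.coeff f.natDegree = 1 from hf, mul_one, sub_self]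
  · rw [hr i hi, coeff_eq_zero_of_natDegree_lt hi, mul_zero, sub_zero]

theorem coeff_central_of_pos {G : K[X]} (hn : 0 < Module.finrank K L) (i : ℕ) :
    (central σ G).coeff i = if Module.finrank K L ∣ i then
      algebraMap K L (G.coeff (i / Module.finrank K L)) else 0 := by
  rw [central, aeval_eq_sum_range, coeff_sum]
  simp_rw [← pow_mul, coeff_smul, coeff_X_pow]
  split_ifs with h
  · obtain ⟨j, rfl⟩ := h
    rw [Nat.mul_div_cancel_left _ hn]
    by_cases hj : j ≤ G.natDegree
    · rw [Finset.sum_eq_single_of_mem j (by simpa using Nat.lt_succ_iff.2 hj), if_pos rfl,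
        Algebra.smul_def, mul_one]
      intro b _ hb
      rw [if_neg (fun h => hb (Nat.eq_of_mul_eq_mul_left hn h).symm), smul_zero]
    · rw [Polynomial.coeff_eq_zero_of_natDegree_lt (not_le.1 hj), map_zero]
      refine Finset.sum_eq_zero fun b hb => ?_
      rw [if_neg, smul_zero]
      intro h
      have := Nat.eq_of_mul_eq_mul_left hn h
      rw [Finset.mem_range] at hb
      omega
  · refine Finset.sum_eq_zero fun b _ => ?_
    rw [if_neg (fun hb => h ⟨b, hb⟩), smul_zero]

/-- Taking `x` out on the left costs `σ⁻¹` on each coefficient. The degree bound on the quotient is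
what later contradicts the minimality of a generator. -/
theorem X_mul_eq_of_coeff_zero {p : TwistedPoly σ} (h : p.coeff 0 = 0) :
    ∃ q, p = X σ * q ∧ ∀ d, p ∈ degreeLT σ (d + 1) → q ∈ degreeLT σ d := by
  refine ⟨∑ i ∈ SkewPolynomial.support p, C σ (σ.symm (p.coeff i)) * X σ ^ (i - 1), ?_, ?_⟩
  · conv_lhs => rw [eq_sum p]
    rw [Finset.mul_sum]
    refine Finset.sum_congr rfl fun i hi => ?_
    have : i ≠ 0 := by
      rintro rfl
      exact SkewPolynomial.mem_support_iff.1 hi h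
    rw [← mul_assoc, X_mul_C, AlgEquiv.apply_symm_apply, mul_assoc, ← pow_succ',
      Nat.sub_add_cancel (by omega)]
  · intro d hd i hi
    rw [coeff_sum]
    refine Finset.sum_eq_zero fun j hj => ?_
    rw [coeff_C_mul_X_pow, if_neg]
    intro hij
    rcases eq_or_ne j 0 with rfl | hj0
    · exact SkewPolynomial.mem_support_iff.1 hj h
    · exact SkewPolynomial.mem_support_iff.1 hj (hd j (show d + 1 ≤ j by omega))

theorem eq_mul_X_of_coeff_zero {p : TwistedPoly σ} (h : p.coeff 0 = 0) :
    ∃ q, p = q * X σ ∧ ∀ d, p ∈ degreeLT σ (d + 1) → q ∈ degreeLT σ d := by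
  refine ⟨∑ i ∈ SkewPolynomial.support p, C σ (p.coeff i) * X σ ^ (i - 1), ?_, ?_⟩
  · conv_lhs => rw [eq_sum p]
    rw [Finset.sum_mul]
    refine Finset.sum_congr rfl fun i hi => ?_
    have : i ≠ 0 := by
      rintro rfl
      exact SkewPolynomial.mem_support_iff.1 hi h
    rw [mul_assoc, ← pow_succ, Nat.sub_add_cancel (by omega)]
  · intro d hd i hi
    rw [coeff_sum]
    refine Finset.sum_eq_zero fun j hj => ?_
    rw [coeff_C_mul_X_pow, if_neg]
    intro hij
    rcases eq_or_ne j 0 with rfl | hj0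
    · exact SkewPolynomial.mem_support_iff.1 hj h
    · exact SkewPolynomial.mem_support_iff.1 hj (hd j (show d + 1 ≤ j by omega))

variable [FiniteDimensional K L]

theorem coeff_central (G : K[X]) (i : ℕ) :
    (central σ G).coeff i = if Module.finrank K L ∣ i then
      algebraMap K L (G.coeff (i / Module.finrank K L)) else 0 :=
  coeff_central_of_pos Module.finrank_pos i

theorem natDegree_central {G : K[X]} (hG : G.Monic) :
    (central σ G).natDegree = G.natDegree * Module.finrank K L := by
  refine natDegree_eq_of_mem (fun i hi => ?_) ?_
  · rw [coeff_central]
    split_ifs with h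
    · obtain ⟨j, rfl⟩ := h
      rw [Nat.mul_div_cancel_left _ Module.finrank_pos, Polynomial.coeff_eq_zero_of_natDegree_lt,
        map_zero]
      by_contra hj
      have := Nat.mul_le_mul_left (Module.finrank K L) (not_lt.1 hj)
      rw [mul_comm G.natDegree] at hi
      omega
    · rfl
  · rw [coeff_central, if_pos (dvd_mul_left _ _), Nat.mul_div_cancel _ Module.finrank_pos,
      hG.coeff_natDegree]
    simp

theorem monic_central {G : K[X]} (hG : G.Monic) : (central σ G).Monic := by
  rw [Monic, natDegree_central hG, coeff_central, if_pos (dvd_mul_left _ _),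
    Nat.mul_div_cancel _ Module.finrank_pos, hG.coeff_natDegree, map_one]

theorem exists_eq_central {r : TwistedPoly σ}
    (h : ∀ i, r.coeff i ≠ 0 → Module.finrank K L ∣ i)
    (h' : ∀ i, r.coeff i ∈ (algebraMap K L).range) : ∃ G : K[X], r = central σ G := by
  choose c hc using h'
  refine ⟨∑ j ∈ Finset.range (r.natDegree + 1), monomial j (c (Module.finrank K L * j)), ?_⟩
  ext i
  rw [coeff_central]
  split_ifs with hi
  · obtain ⟨j, rfl⟩ := hi
    rw [Nat.mul_div_cancel_left _ Module.finrank_pos, finsetSum_coeff]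
    simp_rw [coeff_monomial]
    rw [Finset.sum_ite_eq']
    split_ifs with hj
    · rw [hc]
    · rw [map_zero]
      rw [Finset.mem_range] at hj
      refine coeff_eq_zero_of_natDegree_lt ?_
      have := Nat.le_mul_of_pos_left j (Module.finrank_pos (R := K) (M := L))
      omega
  · by_contra hne
    exact hi (h i hne)

variable [IsGalois K L]

/-- The stabiliser of `a` contains a generator, hence is the whole Galois group. -/
theorem mem_range_of_fixed (hσ : Subgroup.zpowers σ = ⊤) {a : L} (h : σ a = a) :
    a ∈ (algebraMap K L).range := by
  refine (IsGalois.mem_range_algebraMap_iff_fixed a).2 ?_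
  intro g
  have hg : g ∈ Subgroup.zpowers σ := hσ ▸ Subgroup.mem_top g
  have hle : Subgroup.zpowers σ ≤ MulAction.stabilizer (L ≃ₐ[K] L) a := by
    rw [Subgroup.zpowers_le]
    exact h
  exact hle hg

theorem finrank_dvd_of_pow_eq_one (hσ : Subgroup.zpowers σ = ⊤) {i : ℕ} (h : σ ^ i = 1) :
    Module.finrank K L ∣ i := by
  rw [← IsGalois.card_aut_eq_finrank K L, ← orderOf_eq_card_of_zpowers_eq_top hσ]
  exact orderOf_dvd_of_pow_eq_one h

theorem pow_finrank_eq_one : σ ^ Module.finrank K L = 1 := by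
  rw [← IsGalois.card_aut_eq_finrank K L]
  exact pow_card_eq_one'

/-- The centre of the twisted polynomial ring. -/
theorem exists_eq_central_of_commute (hσ : Subgroup.zpowers σ = ⊤) {r : TwistedPoly σ}
    (hC : ∀ a, r * C σ a = C σ a * r) (hX : r * X σ = X σ * r) : ∃ G : K[X], r = central σ G := by
  refine exists_eq_central (fun i hi => ?_) (fun i => ?_)
  -- Commuting with constants reads `r_i σ^i(a) = a r_i`, so `σ ^ i = 1` wherever `r_i ≠ 0`;
  -- commuting with `x` makes each `r_i` fixed by `σ`.
  · refine finrank_dvd_of_pow_eq_one hσ (AlgEquiv.ext fun a => ?_)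
    have := congrArg (coeff · i) (hC a)
    simp only [coeff_mul_C, coeff_C_mul] at this
    rw [mul_comm] at this
    exact mul_right_cancel₀ hi this
  · have := congrArg (coeff · (i + 1)) hX
    simp only [coeff_mul_X_succ, coeff_X_mul_succ] at this
    exact mem_range_of_fixed hσ this.symm

theorem coeff_zero_ne_zero_of_irreducible {F : K[X]} (hF : F.Monic) (hFirr : Irreducible F)
    (hFX : F ≠ Polynomial.X) : F.coeff 0 ≠ 0 := by
  intro h
  have := (irreducible_X.associated_of_dvd hFirr (X_dvd_iff.2 h))
  exact hFX (eq_of_monic_of_associated hF monic_X this.symm)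

/-- The indeterminate is invertible modulo `F(x ^ n)`. -/
theorem exists_inv_X {F : K[X]} (hF : F.Monic) (hFirr : Irreducible F)
    (hFX : F ≠ Polynomial.X) :
    ∃ u : TwistedPoly σ, u * X σ - 1 ∈ Ideal.span {central σ F} ∧
      X σ * u - 1 ∈ Ideal.span {central σ F} := by
  have h0 := coeff_zero_ne_zero_of_irreducible hF hFirr hFX
  have h1 := congrArg (central σ) (divX_mul_X_add F)
  set n := Module.finrank K L with hn
  have hX : X σ ^ n = X σ ^ (n - 1) * X σ := by
    rw [← pow_succ, Nat.sub_add_cancel Module.finrank_pos]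
  have h2 : central σ F.divX * (X σ ^ (n - 1) * X σ) + algebraMap K _ (F.coeff 0) =
      central σ F := by
    rw [← h1, ← hX]
    simp [central, hn]
  have h3 : algebraMap K (TwistedPoly σ) (-(F.coeff 0)⁻¹) * (central σ F.divX *
      (X σ ^ (n - 1) * X σ)) - 1 = algebraMap K (TwistedPoly σ) (-(F.coeff 0)⁻¹) * central σ F := by
    rw [← h2, mul_add, ← map_mul, neg_mul, inv_mul_cancel₀ h0]
    simp [sub_eq_add_neg]
  -- From `F = y G + F(0)` one gets `-F(0)⁻¹ G(x ^ n) x ^ n ≡ 1`. Splitting off one `x` on either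
  -- side gives the inverse, because `G(x ^ n)` is central.
  refine ⟨algebraMap K (TwistedPoly σ) (-(F.coeff 0)⁻¹) * (central σ F.divX * X σ ^ (n - 1)),
    ?_, ?_⟩
  · rw [mul_assoc, mul_assoc, h3]
    exact Ideal.mul_mem_left _ _ (Ideal.mem_span_singleton_self _)
  · rw [← mul_assoc, ← Algebra.commutes, mul_assoc, ← mul_assoc (X σ), ← central_commute, mul_assoc,
      ← pow_succ', pow_succ, h3]
    exact Ideal.mul_mem_left _ _ (Ideal.mem_span_singleton_self _)

/-- `R / R F(x ^ n)` is a simple ring. -/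
theorem eq_span_central_of_isTwoSided (hσ : Subgroup.zpowers σ = ⊤) {F : K[X]} (hF : F.Monic)
    (hFirr : Irreducible F) (hFX : F ≠ Polynomial.X) (I : Ideal (TwistedPoly σ)) [I.IsTwoSided]
    (hI : I ≠ ⊤) (hFI : central σ F ∈ I) : I = Ideal.span {central σ F} := by
  obtain ⟨p, hp⟩ := exists_eq_span_singleton I
  have hp0 : p ≠ 0 := by
    rintro rfl
    rw [Ideal.span_singleton_zero] at hp
    rw [hp] at hFI
    exact (monic_central hF).ne_zero hFI
  obtain ⟨g, hg, -, hpg⟩ := exists_monic hp0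
  rw [hpg, span_C_mul (coeff_natDegree_ne_zero hp0)] at hp
  have hgI : g ∈ I := hp ▸ Ideal.mem_span_singleton_self g
  have hgdeg := mem_degreeLT_natDegree g
  -- The ideal is two-sided, so `g a` lies in `R g` without exceeding the degree of `g`; it is
  -- therefore a constant multiple of `g`, and the leading coefficient names the constant.
  have hC : ∀ a, g * C σ a = C σ ((σ ^ g.natDegree) a) * g := fun a => by
    have h1 : g * C σ a ∈ degreeLT σ (g.natDegree + 1) := fun i hi => by
      rw [coeff_mul_C, hgdeg i hi, zero_mul]
    have h2 := eq_C_mul_of_mem_span hg h1 (hp ▸ I.mul_mem_right _ hgI)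
    rwa [coeff_mul_C, show g.coeff g.natDegree = 1 from hg, one_mul] at h2
  obtain ⟨u, hu, -⟩ := exists_inv_X (σ := σ) hF hFirr hFX
  have hFI' : Ideal.span {central σ F} ≤ I := (Ideal.span_singleton_le_iff_mem I).2 hFI
  -- Otherwise `g = x q`, and inverting `x` modulo `F(x ^ n)` puts the shorter `q` in the ideal.
  have hg0 : g.coeff 0 ≠ 0 := by
    intro h0
    obtain ⟨q, hq, hqd⟩ := X_mul_eq_of_coeff_zero h0
    have hqI : q ∈ I := by
      have h1 := I.mul_mem_right q (hFI' hu)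
      have h2 := I.mul_mem_left u hgI
      rw [hq, ← mul_assoc] at h2
      have := I.sub_mem h2 h1
      rwa [sub_mul, one_mul, sub_sub_cancel] at this
    have := eq_zero_of_mem_span hg (hqd _ hgdeg) (hp ▸ hqI)
    rw [this, mul_zero] at hq
    exact hg.ne_zero hq
  have hpow : σ ^ g.natDegree = 1 := AlgEquiv.ext fun a => by
    have := congrArg (coeff · 0) (hC a)
    simp only [coeff_mul_C, coeff_C_mul] at this
    rw [mul_comm] at this
    exact (mul_right_cancel₀ hg0 this).symm
  -- The top terms cancel because `g` is monic, so the difference is a constant multiple of `g`; its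
  -- constant coefficient is zero while that of `g` is not.
  have hX : g * X σ = X σ * g := by
    rw [← sub_eq_zero]
    have h1 : g * X σ - X σ * g ∈ degreeLT σ (g.natDegree + 1) := by
      intro i hi
      obtain ⟨i, rfl⟩ := Nat.exists_eq_succ_of_ne_zero (by omega : i ≠ 0)
      rw [coeff_sub, Nat.succ_eq_add_one, coeff_mul_X_succ, coeff_X_mul_succ]
      rcases (Nat.succ_le_succ_iff.1 hi).eq_or_lt with rfl | hi
      · rw [show g.coeff g.natDegree = 1 from hg, map_one, sub_self]
      · rw [hgdeg i hi, map_zero, sub_zero]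
    have h2 := eq_C_mul_of_mem_span hg h1 (hp ▸ I.sub_mem (I.mul_mem_right _ hgI)
      (I.mul_mem_left _ hgI))
    have h3 := congrArg (coeff · 0) h2
    simp only [coeff_C_mul, coeff_sub _ _ 0, coeff_mul_X_zero, coeff_X_mul_zero, sub_zero] at h3
    rw [h2, (mul_eq_zero.1 h3.symm).resolve_right hg0, map_zero, zero_mul]
  obtain ⟨G, rfl⟩ := exists_eq_central_of_commute hσ (fun a => by rw [hC, hpow]; rfl) hX
  refine le_antisymm ?_ hFI'
  rw [hp, Ideal.span_singleton_le_iff_mem]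
  -- If `F` does not divide `G`, a Bézout relation evaluated at `x ^ n` puts `1` in the ideal.
  by_cases hd : F ∣ G
  · obtain ⟨H, rfl⟩ := hd
    rw [mul_comm]
    exact Ideal.mem_span_singleton'.2 ⟨central σ H, (map_mul _ _ _).symm⟩
  · exfalso
    obtain ⟨a, b, hab⟩ := hFirr.coprime_iff_not_dvd.2 hd
    refine hI ((Ideal.eq_top_iff_one I).2 ?_)
    have h1 := congrArg (central σ) hab
    have h2 : central σ a * central σ F + central σ b * central σ G = 1 := by
      simpa [central] using h1
    rw [← h2]
    exact I.add_mem (I.mul_mem_left _ hFI) (I.mul_mem_left _ hgI)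

/-- The module `R / R f` is faithful over `R / R F(x ^ n)`. -/
theorem mem_span_central_of_annihilates (hσ : Subgroup.zpowers σ = ⊤) {F : K[X]} (hF : F.Monic)
    (hFirr : Irreducible F) (hFX : F ≠ Polynomial.X) {f : TwistedPoly σ} (hf : ¬ IsUnit f)
    (hfF : central σ F ∈ Ideal.span {f}) {r : TwistedPoly σ}
    (hr : ∀ u : QuotientModule f, r • u = 0) : r ∈ Ideal.span {central σ F} := by
  -- The annihilator is two-sided, contains `F(x ^ n)`, and is proper because `f` is not a unit.
  rw [← eq_span_central_of_isTwoSided hσ hF hFirr hFX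
    (Module.annihilator (TwistedPoly σ) (QuotientModule f)), Module.mem_annihilator]
  · exact hr
  · intro h
    have h1 : (1 : TwistedPoly σ) ∈ Module.annihilator (TwistedPoly σ) (QuotientModule f) :=
      h ▸ Submodule.mem_top
    have h2 := Module.mem_annihilator.1 h1 ((Ideal.span {f}).mkQ 1)
    rw [one_smul] at h2
    obtain ⟨g, hg⟩ := Ideal.mem_span_singleton'.1 ((Submodule.Quotient.mk_eq_zero _).1 h2)
    exact hf (IsUnit.of_mul_eq_one_right g hg)
  · rw [Module.mem_annihilator]
    intro u
    obtain ⟨p, rfl⟩ := (Ideal.span {f}).mkQ_surjective u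
    rw [← map_smul, smul_eq_mul, central_commute]
    exact (Submodule.Quotient.mk_eq_zero _).2 (Ideal.mul_mem_left _ _ hfF)

end Central

/-! ### Idealisers, centraliser and centre of the codes -/

section Code

variable {K L : Type*} [Field K] [Field L] [Algebra K L] {σ : L ≃ₐ[K] L}
  [FiniteDimensional K L] [IsGalois K L] {ρ : L ≃+* L} {η : L} {F : K[X]} {d : ℕ}

theorem mk_eq_zero_iff {F : K[X]} {p : TwistedPoly σ} :
    Ideal.Quotient.mk (Ideal.span {central σ F}) p = 0 ↔ p ∈ Ideal.span {central σ F} :=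
  Ideal.Quotient.eq_zero_iff_mem

theorem mk_mem_twistedCode {p : TwistedPoly σ} (hp : p ∈ twistedPolys σ ρ η d) :
    Ideal.Quotient.mk (Ideal.span {central σ F}) p ∈ twistedCode σ ρ η F d :=
  Submodule.mem_map_of_mem hp

theorem exists_of_mem_twistedCode {u : QuotientRing σ F} (hu : u ∈ twistedCode σ ρ η F d) :
    ∃ p ∈ twistedPolys σ ρ η d, Ideal.Quotient.mk (Ideal.span {central σ F}) p = u :=
  Submodule.mem_map.1 hu

theorem mk_injective_of_degreeLT (hF : F.Monic) {p q : TwistedPoly σ}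
    (hp : p ∈ degreeLT σ (central σ F).natDegree) (hq : q ∈ degreeLT σ (central σ F).natDegree)
    (h : Ideal.Quotient.mk (Ideal.span {central σ F}) p = Ideal.Quotient.mk _ q) : p = q := by
  rw [← sub_eq_zero]
  exact eq_zero_of_mem_span (monic_central hF) (sub_mem hp hq) (Ideal.Quotient.eq.1 h)

/-- Below the degree of `F(x ^ n)` a class has only one representative, so membership in the code
can be read off the coefficients. -/
theorem mem_twistedPolys_of_mk_mem (hF : F.Monic) (hd : d < (central σ F).natDegree)
    {p : TwistedPoly σ} (hp : p ∈ degreeLT σ (central σ F).natDegree)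
    (h : Ideal.Quotient.mk (Ideal.span {central σ F}) p ∈ twistedCode σ ρ η F d) :
    p ∈ twistedPolys σ ρ η d := by
  obtain ⟨q, hq, hqp⟩ := exists_of_mem_twistedCode h
  rwa [← mk_injective_of_degreeLT hF (fun i hi => hq.1 i (by omega)) hp hqp]

omit [FiniteDimensional K L] [IsGalois K L] in
theorem C_mul_X_pow_mem_twistedPolys (a : L) {i : ℕ} (hi : i ≠ 0) (hid : i < d) :
    C σ a * X σ ^ i ∈ twistedPolys σ ρ η d := by
  refine ⟨fun j hj => ?_, ?_⟩
  · rw [coeff_C_mul_X_pow, if_neg (by omega)]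
  · rw [coeff_C_mul_X_pow, coeff_C_mul_X_pow, if_neg (by omega), if_neg hi.symm, map_zero,
      mul_zero]

omit [FiniteDimensional K L] [IsGalois K L] in
theorem X_pow_mem_twistedPolys {i : ℕ} (hi : i ≠ 0) (hid : i < d) :
    X σ ^ i ∈ twistedPolys σ ρ η d := by
  simpa using C_mul_X_pow_mem_twistedPolys (σ := σ) (ρ := ρ) (η := η) 1 hi hid

omit [FiniteDimensional K L] [IsGalois K L] in
-- This word detects `η` and `ρ`; the monomials of degrees `1, …, d - 1` belong to the code whatever
-- these are.
theorem one_add_mem_twistedPolys (hd : d ≠ 0) :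
    1 + C σ η * X σ ^ d ∈ twistedPolys σ ρ η d := by
  refine ⟨fun j hj => ?_, ?_⟩
  · rw [coeff_add, coeff_one, coeff_C_mul_X_pow, if_neg (by omega), if_neg (by omega), add_zero]
  · rw [coeff_add, coeff_add, coeff_one, coeff_one, coeff_C_mul_X_pow, coeff_C_mul_X_pow,
      if_neg hd, if_pos rfl, if_pos rfl, if_neg hd.symm, map_add, map_one, map_zero]
    ring

theorem isUnit_mk_X (hF : F.Monic) (hFirr : Irreducible F) (hFX : F ≠ Polynomial.X) :
    IsUnit (Ideal.Quotient.mk (Ideal.span {central σ F}) (X σ)) := by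
  obtain ⟨u, hu, hu'⟩ := exists_inv_X (σ := σ) hF hFirr hFX
  refine isUnit_iff_exists.2 ⟨Ideal.Quotient.mk _ u, ?_, ?_⟩
  · rw [← map_mul, ← map_one (Ideal.Quotient.mk _), Ideal.Quotient.eq]
    exact hu'
  · rw [← map_mul, ← map_one (Ideal.Quotient.mk _), Ideal.Quotient.eq]
    exact hu

variable (hF : F.Monic) (hFirr : Irreducible F) (hFX : F ≠ Polynomial.X) (hd : 2 < d)
  (hdN : 2 * d ≤ (central σ F).natDegree)

include hF hFirr hFX hd hdN in
-- The degree of a representative `c` of `a` is first brought below `d`. Then `c x ^ (d - 1)` has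
-- degree below `2 d`, so no reduction occurs: the vanishing of its coefficients above `d` leaves
-- `c₀ + c₁ x`, and its zero constant coefficient forces `c₁ = 0`.
theorem exists_C_of_mem_leftIdealiser {a : QuotientRing σ F}
    (ha : a ∈ leftIdealiser (twistedCode σ ρ η F d)) :
    ∃ α : L, a = Ideal.Quotient.mk _ (C σ α) := by
  have ha' : ∀ p ∈ twistedPolys σ ρ η d,
      a * Ideal.Quotient.mk _ p ∈ twistedCode σ ρ η F d := fun p hp => ha _ (mk_mem_twistedCode hp)
  obtain ⟨c, hc, rfl⟩ : ∃ c ∈ degreeLT σ d, a = Ideal.Quotient.mk _ c := by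
    by_cases hη : η = 0
    · obtain ⟨c, hc, hca⟩ := exists_of_mem_twistedCode (ha' 1 (by
        simpa [hη] using one_add_mem_twistedPolys (σ := σ) (ρ := ρ) (η := η) (d := d) (by omega)))
      refine ⟨c, fun i hi => ?_, by rw [hca, map_one, mul_one]⟩
      rcases hi.eq_or_lt with rfl | hi
      · rw [hc.2, hη, zero_mul]
      · exact hc.1 i hi
    -- Here `1` need not be a codeword. With `a x = c` in the code, the coefficient `η ρ(c₀)` of `x
    -- ^ (d + 1)` in `a x ^ 2 = c x` must vanish, so `c = q x` and `x` cancels. Both `x` and `x ^ 2`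
    -- are codewords because `2 < d`.
    · obtain ⟨c, hc, hca⟩ := exists_of_mem_twistedCode
        (ha' _ (X_pow_mem_twistedPolys one_ne_zero (by omega)))
      have h2 := ha' _ (X_pow_mem_twistedPolys two_ne_zero (by omega))
      rw [pow_one] at hca
      rw [pow_two, map_mul, ← mul_assoc, ← hca, ← map_mul] at h2
      have h3 := mem_twistedPolys_of_mk_mem hF (by omega) (fun i hi => by
        obtain ⟨i, rfl⟩ := Nat.exists_eq_succ_of_ne_zero (by omega : i ≠ 0)
        rw [Nat.succ_eq_add_one, coeff_mul_X_succ]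
        exact hc.1 i (by omega)) h2
      have h4 := h3.1 (d + 1) (by omega)
      rw [coeff_mul_X_succ, hc.2, mul_eq_zero, EmbeddingLike.map_eq_zero_iff] at h4
      obtain ⟨q, rfl, hq⟩ := eq_mul_X_of_coeff_zero (h4.resolve_left hη)
      rw [map_mul] at hca
      exact ⟨q, hq d fun i hi => hc.1 i (by omega),
        ((isUnit_mk_X hF hFirr hFX).mul_left_injective hca).symm⟩
  have h1 := ha' _ (X_pow_mem_twistedPolys (i := d - 1) (by omega) (by omega))
  rw [← map_mul] at h1
  have h2 := mem_twistedPolys_of_mk_mem hF (by omega) (fun i hi => by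
    rw [coeff_mul_X_pow, if_pos (by omega)]
    exact hc _ (by omega)) h1
  refine ⟨c.coeff 0, congrArg _ (eq_C_of_mem_degreeLT fun i hi => ?_)⟩
  rcases hi.eq_or_lt with rfl | hi
  · have := h2.2
    rw [coeff_mul_X_pow, coeff_mul_X_pow, if_pos (by omega), if_neg (by omega), map_zero,
      mul_zero] at this
    rwa [show d - (d - 1) = 1 by omega] at this
  · have := h2.1 (i + (d - 1)) (by omega)
    rwa [coeff_mul_X_pow, if_pos (by omega), Nat.add_sub_cancel] at this

include hF hFirr hFX hd hdN in
-- The mirror image of the left case: multiplying by powers of `x` on the left applies powers of `σ`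
-- to the coefficients, which does not affect their vanishing.
theorem exists_C_of_mem_rightIdealiser {a : QuotientRing σ F}
    (ha : a ∈ rightIdealiser (twistedCode σ ρ η F d)) :
    ∃ α : L, a = Ideal.Quotient.mk _ (C σ α) := by
  have ha' : ∀ p ∈ twistedPolys σ ρ η d,
      Ideal.Quotient.mk _ p * a ∈ twistedCode σ ρ η F d := fun p hp => ha _ (mk_mem_twistedCode hp)
  obtain ⟨c, hc, rfl⟩ : ∃ c ∈ degreeLT σ d, a = Ideal.Quotient.mk _ c := by
    by_cases hη : η = 0
    · obtain ⟨c, hc, hca⟩ := exists_of_mem_twistedCode (ha' 1 (by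
        simpa [hη] using one_add_mem_twistedPolys (σ := σ) (ρ := ρ) (η := η) (d := d) (by omega)))
      refine ⟨c, fun i hi => ?_, by rw [hca, map_one, one_mul]⟩
      rcases hi.eq_or_lt with rfl | hi
      · rw [hc.2, hη, zero_mul]
      · exact hc.1 i hi
    · obtain ⟨c, hc, hca⟩ := exists_of_mem_twistedCode
        (ha' _ (X_pow_mem_twistedPolys one_ne_zero (by omega)))
      have h2 := ha' _ (X_pow_mem_twistedPolys two_ne_zero (by omega))
      rw [pow_one] at hca
      rw [pow_two, map_mul, mul_assoc, ← hca, ← map_mul] at h2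
      have h3 := mem_twistedPolys_of_mk_mem hF (by omega) (fun i hi => by
        obtain ⟨i, rfl⟩ := Nat.exists_eq_succ_of_ne_zero (by omega : i ≠ 0)
        rw [Nat.succ_eq_add_one, coeff_X_mul_succ, hc.1 i (by omega), map_zero]) h2
      have h4 := h3.1 (d + 1) (by omega)
      rw [coeff_X_mul_succ, EmbeddingLike.map_eq_zero_iff, hc.2, mul_eq_zero,
        EmbeddingLike.map_eq_zero_iff] at h4
      obtain ⟨q, rfl, hq⟩ := X_mul_eq_of_coeff_zero (h4.resolve_left hη)
      rw [map_mul] at hca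
      exact ⟨q, hq d fun i hi => hc.1 i (by omega),
        ((isUnit_mk_X hF hFirr hFX).mul_right_injective hca).symm⟩
  have h1 := ha' _ (X_pow_mem_twistedPolys (i := d - 1) (by omega) (by omega))
  rw [← map_mul] at h1
  have h2 := mem_twistedPolys_of_mk_mem hF (by omega) (fun i hi => by
    rw [coeff_X_pow_mul, if_pos (by omega), hc _ (by omega), map_zero]) h1
  refine ⟨c.coeff 0, congrArg _ (eq_C_of_mem_degreeLT fun i hi => ?_)⟩
  rcases hi.eq_or_lt with rfl | hi
  · have := h2.2
    rw [coeff_X_pow_mul, coeff_X_pow_mul, if_pos (by omega), if_neg (by omega), map_zero,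
      mul_zero, EmbeddingLike.map_eq_zero_iff] at this
    rwa [show d - (d - 1) = 1 by omega] at this
  · have := h2.1 (i + (d - 1)) (by omega)
    rwa [coeff_X_pow_mul, if_pos (by omega), Nat.add_sub_cancel,
      EmbeddingLike.map_eq_zero_iff] at this

theorem C_mem_leftIdealiser {α : L} (hα : η = 0 ∨ ρ α = α) :
    Ideal.Quotient.mk _ (C σ α) ∈ leftIdealiser (twistedCode σ ρ η F d) := by
  intro u hu
  obtain ⟨p, hp, rfl⟩ := exists_of_mem_twistedCode hu
  rw [← map_mul]
  refine mk_mem_twistedCode ⟨fun i hi => by rw [coeff_C_mul, hp.1 i hi, mul_zero], ?_⟩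
  rw [coeff_C_mul, coeff_C_mul, hp.2, map_mul]
  rcases hα with rfl | hα
  · simp
  · rw [hα]; ring

theorem C_mem_rightIdealiser {α : L} (hα : η = 0 ∨ ρ α = (σ ^ d) α) :
    Ideal.Quotient.mk _ (C σ α) ∈ rightIdealiser (twistedCode σ ρ η F d) := by
  intro u hu
  obtain ⟨p, hp, rfl⟩ := exists_of_mem_twistedCode hu
  rw [← map_mul]
  refine mk_mem_twistedCode ⟨fun i hi => by rw [coeff_mul_C, hp.1 i hi, zero_mul], ?_⟩
  rw [coeff_mul_C, coeff_mul_C, hp.2, map_mul]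
  rcases hα with rfl | hα
  · simp
  · rw [pow_zero, AlgEquiv.one_apply, hα]; ring

include hF hFirr hFX hd hdN in
-- The test word gives `α (1 + η x ^ d) = α + α η x ^ d`, whose top coefficient has to be `η ρ(α)`.
theorem mem_leftIdealiser_iff (hη : η ≠ 0) {a : QuotientRing σ F} :
    a ∈ leftIdealiser (twistedCode σ ρ η F d) ↔
      ∃ α : L, ρ α = α ∧ Ideal.Quotient.mk _ (C σ α) = a := by
  constructor
  · intro ha
    obtain ⟨α, rfl⟩ := exists_C_of_mem_leftIdealiser hF hFirr hFX hd hdN ha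
    refine ⟨α, ?_, rfl⟩
    have h1 := ha _ (mk_mem_twistedCode (one_add_mem_twistedPolys (by omega)))
    rw [← map_mul] at h1
    have h2 := (mem_twistedPolys_of_mk_mem hF (by omega) (fun i hi => by
      rw [coeff_C_mul, coeff_add, coeff_one, coeff_C_mul_X_pow, if_neg (by omega),
        if_neg (by omega), add_zero, mul_zero]) h1).2
    rw [coeff_C_mul, coeff_C_mul, coeff_add, coeff_add, coeff_one, coeff_one, coeff_C_mul_X_pow,
      coeff_C_mul_X_pow, if_neg (by omega), if_pos rfl, if_pos rfl, if_neg (by omega), add_zero,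
      zero_add, mul_one, mul_comm] at h2
    exact (mul_left_cancel₀ hη h2).symm
  · rintro ⟨α, hα, rfl⟩
    exact C_mem_leftIdealiser (Or.inr hα)

include hF hFirr hFX hd hdN in
-- Moving `α` past `x ^ d` gives `(1 + η x ^ d) α = α + η σ^d(α) x ^ d`, whence the twist in the
-- condition.
theorem mem_rightIdealiser_iff (hη : η ≠ 0) {a : QuotientRing σ F} :
    a ∈ rightIdealiser (twistedCode σ ρ η F d) ↔
      ∃ α : L, ρ α = (σ ^ d) α ∧ Ideal.Quotient.mk _ (C σ α) = a := by
  constructor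
  · intro ha
    obtain ⟨α, rfl⟩ := exists_C_of_mem_rightIdealiser hF hFirr hFX hd hdN ha
    refine ⟨α, ?_, rfl⟩
    have h1 := ha _ (mk_mem_twistedCode (one_add_mem_twistedPolys (by omega)))
    rw [← map_mul] at h1
    have h2 := (mem_twistedPolys_of_mk_mem hF (by omega) (fun i hi => by
      rw [coeff_mul_C, coeff_add, coeff_one, coeff_C_mul_X_pow, if_neg (by omega),
        if_neg (by omega), add_zero, zero_mul]) h1).2
    rw [coeff_mul_C, coeff_mul_C, coeff_add, coeff_add, coeff_one, coeff_one, coeff_C_mul_X_pow,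
      coeff_C_mul_X_pow, if_neg (by omega), if_pos rfl, if_pos rfl, if_neg (by omega), add_zero,
      zero_add, one_mul, pow_zero, AlgEquiv.one_apply] at h2
    exact (mul_left_cancel₀ hη h2).symm
  · rintro ⟨α, hα, rfl⟩
    exact C_mem_rightIdealiser (Or.inr hα)

include hF hFirr hFX hd hdN in
theorem coe_leftIdealiser_zero :
    (leftIdealiser (twistedCode σ ρ 0 F d) : Set (QuotientRing σ F)) =
      Set.range (fun a : L => Ideal.Quotient.mk _ (C σ a)) := by
  ext a
  constructor
  · intro ha
    obtain ⟨α, rfl⟩ := exists_C_of_mem_leftIdealiser hF hFirr hFX hd hdN ha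
    exact ⟨α, rfl⟩
  · rintro ⟨α, rfl⟩
    exact C_mem_leftIdealiser (Or.inl rfl)

include hF hFirr hFX hd hdN in
theorem coe_rightIdealiser_zero :
    (rightIdealiser (twistedCode σ ρ 0 F d) : Set (QuotientRing σ F)) =
      Set.range (fun a : L => Ideal.Quotient.mk _ (C σ a)) := by
  ext a
  constructor
  · intro ha
    obtain ⟨α, rfl⟩ := exists_C_of_mem_rightIdealiser hF hFirr hFX hd hdN ha
    exact ⟨α, rfl⟩
  · rintro ⟨α, rfl⟩
    exact C_mem_rightIdealiser (Or.inl rfl)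

include hF hFirr hFX hd in
-- The code contains `x` and every `a x`. Cancelling the unit `x` shows that the centraliser
-- commutes with all constants, and constants and `x` generate the ring.
theorem codeCentraliser_eq_center :
    codeCentraliser (twistedCode σ ρ η F d) =
      Subalgebra.center (fixedBase K ρ) (QuotientRing σ F) := by
  refine le_antisymm (fun z hz => ?_) (Subalgebra.center_le_centralizer _ _)
  have h1 : ∀ p ∈ twistedPolys σ ρ η d, Commute (Ideal.Quotient.mk _ p) z := fun p hp =>
    (Subalgebra.mem_centralizer_iff _).1 hz _ (mk_mem_twistedCode hp)
  have hX := h1 _ (X_pow_mem_twistedPolys one_ne_zero (by omega))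
  rw [pow_one] at hX
  have hC : ∀ a, Commute (Ideal.Quotient.mk _ (C σ a)) z := fun a => by
    have h2 := h1 _ (C_mul_X_pow_mem_twistedPolys a one_ne_zero (by omega))
    rw [pow_one, map_mul] at h2
    refine (isUnit_mk_X (σ := σ) hF hFirr hFX).mul_left_injective ?_
    change _ * z * _ = z * _ * _
    rw [mul_assoc, ← hX.eq, ← mul_assoc, h2.eq, mul_assoc]
  rw [Subalgebra.mem_center_iff]
  intro b
  obtain ⟨p, rfl⟩ := Ideal.Quotient.mk_surjective b
  change Commute _ _
  rw [eq_sum p, map_sum]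
  refine Commute.sum_left _ _ _ fun i _ => ?_
  rw [map_mul, map_pow]
  exact (hC _).mul_left (hX.pow_left i)

variable (ρ F) in
/-- The constants as an algebra homomorphism into `R / R F(x ^ n)`. -/
def constAlgHom (σ : L ≃ₐ[K] L) : L →ₐ[fixedBase K ρ] QuotientRing σ F where
  __ := (Ideal.Quotient.mk _).comp (C σ)
  commutes' _ := rfl

omit [FiniteDimensional K L] [IsGalois K L] in
theorem C_mem_degreeLT {d : ℕ} (h : 0 < d) (a : L) : C σ a ∈ degreeLT σ d := fun i hi => by
  rw [coeff_C, if_neg (by omega)]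

include hF in
theorem constAlgHom_injective (hN : 0 < (central σ F).natDegree) :
    Function.Injective (constAlgHom ρ F σ) := fun a b h =>
  C_injective (mk_injective_of_degreeLT hF (C_mem_degreeLT hN a) (C_mem_degreeLT hN b) h)

theorem mem_fixedElements {k : Type*} [Field k] [Algebra k L] {ψ : L ≃ₐ[k] L} {a : L} :
    a ∈ fixedElements ψ ↔ ψ a = a := Iff.rfl

omit [FiniteDimensional K L] [IsGalois K L] in
theorem mem_fixedElements_inv_mul {a : L} :
    a ∈ fixedElements ((overBase K ρ)⁻¹ * (σ.restrictScalars (fixedBase K ρ)) ^ d) ↔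
      ρ a = (σ ^ d) a := by
  have h1 : ((σ.restrictScalars (fixedBase K ρ)) ^ d) a = (σ ^ d) a := by
    rw [AlgEquiv.coe_pow, AlgEquiv.coe_pow]; rfl
  have h2 : ((overBase K ρ)⁻¹ * (σ.restrictScalars (fixedBase K ρ)) ^ d) a =
      (overBase K ρ).symm (((σ.restrictScalars (fixedBase K ρ)) ^ d) a) := rfl
  rw [mem_fixedElements, h2, AlgEquiv.symm_apply_eq, h1, eq_comm]
  rfl

include hF hFirr hFX hd hdN in
theorem nonempty_leftIdealiser_equiv (hη : η ≠ 0) :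
    Nonempty (leftIdealiser (twistedCode σ ρ η F d) ≃ₐ[fixedBase K ρ]
      fixedElements (overBase K ρ)) := by
  have h : (fixedElements (overBase K ρ)).map (constAlgHom ρ F σ) =
      leftIdealiser (twistedCode σ ρ η F d) := by
    ext a
    rw [mem_leftIdealiser_iff hF hFirr hFX hd hdN hη, Subalgebra.mem_map]
    rfl
  exact ⟨((Subalgebra.equivMapOfInjective _ _
    (constAlgHom_injective hF (by omega))).trans (Subalgebra.equivOfEq _ _ h)).symm⟩

include hF hFirr hFX hd hdN in
theorem nonempty_rightIdealiser_equiv (hη : η ≠ 0) :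
    Nonempty (rightIdealiser (twistedCode σ ρ η F d) ≃ₐ[fixedBase K ρ]
      fixedElements ((overBase K ρ)⁻¹ * (σ.restrictScalars (fixedBase K ρ)) ^ d)) := by
  have h : (fixedElements ((overBase K ρ)⁻¹ * (σ.restrictScalars (fixedBase K ρ)) ^ d)).map
      (constAlgHom ρ F σ) = rightIdealiser (twistedCode σ ρ η F d) := by
    ext a
    rw [mem_rightIdealiser_iff hF hFirr hFX hd hdN hη, Subalgebra.mem_map]
    simp_rw [mem_fixedElements_inv_mul]
    rfl
  exact ⟨((Subalgebra.equivMapOfInjective _ _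
    (constAlgHom_injective hF (by omega))).trans (Subalgebra.equivOfEq _ _ h)).symm⟩

include hF hFirr hFX hd hdN in
-- An element of the idealiser is a constant, and a constant commutes with `x` exactly when `σ`
-- fixes it.
theorem mem_codeCentre_iff (hσ : Subgroup.zpowers σ = ⊤) {a : QuotientRing σ F} :
    a ∈ codeCentre (twistedCode σ ρ η F d) ↔ a ∈ leftIdealiser (twistedCode σ ρ η F d) ∧
      ∃ c : K, Ideal.Quotient.mk _ (C σ (algebraMap K L c)) = a := by
  have hmem : a ∈ codeCentre (twistedCode σ ρ η F d) ↔ a ∈ leftIdealiser (twistedCode σ ρ η F d) ∧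
      a ∈ codeCentraliser (twistedCode σ ρ η F d) := Iff.rfl
  rw [hmem, codeCentraliser_eq_center hF hFirr hFX hd]
  refine and_congr_right fun ha => ?_
  constructor
  · intro hz
    obtain ⟨α, rfl⟩ := exists_C_of_mem_leftIdealiser hF hFirr hFX hd hdN ha
    have h1 := (Subalgebra.mem_center_iff.1 hz) (Ideal.Quotient.mk _ (X σ))
    rw [← map_mul, ← map_mul, X_mul_C] at h1
    have h2 : ∀ b : L, C σ b * X σ ∈ degreeLT σ (central σ F).natDegree := fun b i hi => by
      have := coeff_C_mul_X_pow (σ := σ) b 1 i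
      rwa [if_neg (by omega), pow_one] at this
    have h3 := mul_right_cancel₀ X_ne_zero (mk_injective_of_degreeLT hF (h2 _) (h2 _) h1)
    obtain ⟨c, rfl⟩ := mem_range_of_fixed hσ (C_injective h3)
    exact ⟨c, rfl⟩
  · rintro ⟨c, rfl⟩
    rw [Subalgebra.mem_center_iff]
    intro b
    obtain ⟨p, rfl⟩ := Ideal.Quotient.mk_surjective b
    rw [← map_mul, ← map_mul, C_algebraMap_mul]

include hF hFirr hFX hd hdN in
theorem nonempty_codeCentre_equiv (hσ : Subgroup.zpowers σ = ⊤) (hη : η ≠ 0) :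
    Nonempty (codeCentre (twistedCode σ ρ η F d) ≃ₐ[fixedBase K ρ] fixedBase K ρ) := by
  have hinj := constAlgHom_injective (σ := σ) (ρ := ρ) hF (by omega)
  have h : codeCentre (twistedCode σ ρ η F d) = ⊥ := by
    ext a
    rw [mem_codeCentre_iff hF hFirr hFX hd hdN hσ, mem_leftIdealiser_iff hF hFirr hFX hd hdN hη,
      Algebra.mem_bot]
    constructor
    · rintro ⟨⟨α, hα, rfl⟩, c, hc⟩
      have := hinj hc
      subst this
      exact ⟨⟨c, hα⟩, rfl⟩
    · rintro ⟨c, rfl⟩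
      exact ⟨⟨_, c.2, rfl⟩, c, rfl⟩
  have : Nontrivial (QuotientRing σ F) := hinj.nontrivial
  exact ⟨(Subalgebra.equivOfEq _ _ h).trans (Algebra.botEquiv _ _)⟩

include hF hFirr hFX hd hdN in
theorem coe_codeCentre_zero (hσ : Subgroup.zpowers σ = ⊤) :
    (codeCentre (twistedCode σ ρ 0 F d) : Set (QuotientRing σ F)) =
      Set.range (fun c : K => Ideal.Quotient.mk _ (C σ (algebraMap K L c))) := by
  ext a
  change a ∈ codeCentre (twistedCode σ ρ 0 F d) ↔ _
  rw [mem_codeCentre_iff hF hFirr hFX hd hdN hσ]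
  refine ⟨fun h => h.2, ?_⟩
  rintro ⟨c, rfl⟩
  exact ⟨C_mem_leftIdealiser (Or.inl rfl), c, rfl⟩

end Code

end TwistedPoly

/-! ### Matrices of semilinear endomorphisms -/

section Semilinear

variable {K L V ι : Type*} [Field K] [Field L] [Algebra K L] [AddCommGroup V] [Module L V]
  [Fintype ι]

/-- The matrix of a semilinear endomorphism with respect to a basis. -/
def semilinearMatrix {σ : L →+* L} (b : Module.Basis ι L V) (φ : V →ₛₗ[σ] V) : Matrix ι ι L :=
  Matrix.of fun i j => b.repr (φ (b j)) i

theorem repr_semilinear_apply {σ : L →+* L} (b : Module.Basis ι L V) (φ : V →ₛₗ[σ] V) (v : V)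
    (i : ι) : b.repr (φ v) i = ∑ k, semilinearMatrix b φ i k * σ (b.repr v k) := by
  conv_lhs => rw [← b.sum_repr v, map_sum, map_sum, Finsupp.finsetSum_apply]
  refine Finset.sum_congr rfl fun k _ => ?_
  rw [LinearMap.map_smulₛₗ, map_smul, Finsupp.smul_apply, smul_eq_mul, mul_comm]
  rfl

theorem semilinearMatrix_mul_map_toMatrix {σ : L →+* L} (b b' : Module.Basis ι L V)
    (φ : V →ₛₗ[σ] V) :
    semilinearMatrix b φ * (b.toMatrix b').map σ = b.toMatrix b' * semilinearMatrix b' φ := by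
  ext i j
  have h := repr_semilinear_apply b φ (b' j) i
  rw [Matrix.mul_apply, Matrix.mul_apply]
  refine h.symm.trans ?_
  conv_lhs => rw [← b'.sum_repr (φ (b' j)), map_sum, Finsupp.finsetSum_apply]
  refine Finset.sum_congr rfl fun k _ => ?_
  rw [map_smul, Finsupp.smul_apply, smul_eq_mul, mul_comm]
  rfl

/-- The norm of the determinant of a semilinear endomorphism does not depend on the basis. -/
theorem norm_det_semilinearMatrix [DecidableEq ι] (σ : L ≃ₐ[K] L)
    (b b' : Module.Basis ι L V) (φ : V →ₛₗ[(σ : L →+* L)] V) :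
    Algebra.norm K (semilinearMatrix b φ).det = Algebra.norm K (semilinearMatrix b' φ).det := by
  -- The two determinants differ by the factor `σ(δ) / δ`, with `δ` the determinant of the change of
  -- basis, and this factor has norm `1`.
  have h := congrArg Matrix.det (semilinearMatrix_mul_map_toMatrix b b' φ)
  rw [Matrix.det_mul, Matrix.det_mul] at h
  have h1 : ((b.toMatrix b').map (σ : L →+* L)).det = σ (b.toMatrix b').det :=
    ((σ : L →+* L).map_det _).symm
  have h0 : (b.toMatrix b').det ≠ 0 := by
    intro h0
    have := congrArg Matrix.det (b.toMatrix_mul_toMatrix_flip b')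
    rw [Matrix.det_mul, h0, zero_mul, Matrix.det_one] at this
    exact zero_ne_one this
  by_cases hK : FiniteDimensional K L
  · have h2 := congrArg (Algebra.norm K) h
    rw [h1, map_mul, map_mul, Algebra.norm_eq_of_algEquiv, mul_comm] at h2
    exact mul_left_cancel₀ (Algebra.norm_ne_zero_iff.2 h0) h2
  -- In infinite degree the norm is `1` by convention.
  · rw [Algebra.norm_eq_one_of_not_module_finite hK, Algebra.norm_eq_one_of_not_module_finite hK]

/-- If a linear endomorphism commutes with a bijective semilinear one, then its characteristic
polynomial is fixed by the field automorphism. -/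
theorem charpoly_map_of_commute_semilinear [DecidableEq ι] {σ : L →+* L}
    (b : Module.Basis ι L V) (φ : V →ₛₗ[σ] V) (Y : V →ₗ[L] V) (h : ∀ v, φ (Y v) = Y (φ v))
    (hdet : (semilinearMatrix b φ).det ≠ 0) :
    (LinearMap.toMatrix b b Y).charpoly.map σ = (LinearMap.toMatrix b b Y).charpoly := by
  set A := semilinearMatrix b φ with hA
  set M := LinearMap.toMatrix b b Y with hM
  -- The matrix form of the commutation. As `A` is invertible, `σ(M)` is conjugate to `M`, and the
  -- characteristic polynomial is invariant under conjugation.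
  have hAM : A * M.map σ = M * A := by
    ext i j
    have h1 := repr_semilinear_apply b φ (Y (b j)) i
    rw [h, ← LinearMap.toMatrix_mulVec_repr b b] at h1
    rw [Matrix.mul_apply, Matrix.mul_apply]
    simp only [Matrix.map_apply, hM, LinearMap.toMatrix_apply]
    rw [← h1, Matrix.mulVec, dotProduct]
    simp only [LinearMap.toMatrix_apply]
    rfl
  have hu : IsUnit A := (Matrix.isUnit_iff_isUnit_det A).2 (isUnit_iff_ne_zero.2 hdet)
  obtain ⟨u, hu⟩ := hu
  have h2 : M.map σ = (u⁻¹ : (Matrix ι ι L)ˣ).val * M * u.val := by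
    rw [mul_assoc, hu, ← hAM, ← hu, Units.inv_mul_cancel_left]
  rw [← Matrix.charpoly_map, h2, Matrix.coe_units_inv, Matrix.charpoly_units_conj']

end Semilinear

/-- If all roots of `G` are roots of the irreducible polynomial `F`, then `deg F ∣ deg G`. -/
theorem natDegree_dvd_of_roots {K Ω : Type*} [Field K] [Field Ω] [Algebra K Ω] [IsAlgClosed Ω]
    {F : K[X]} (hF : F.Monic) (hFirr : Irreducible F) {G : K[X]} (hG : G ≠ 0)
    (h : ∀ a : Ω, aeval a G = 0 → aeval a F = 0) : F.natDegree ∣ G.natDegree := by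
  induction hN : G.natDegree using Nat.strong_induction_on generalizing G with
  | _ N ih =>
    rcases Nat.eq_zero_or_pos N with rfl | hpos
    · exact dvd_zero _
    · obtain ⟨a, ha⟩ := IsAlgClosed.exists_aeval_eq_zero Ω G
        (natDegree_pos_iff_degree_pos.1 (by omega)).ne'
      -- A root of `G` is a root of `F`, so its minimal polynomial is `F`, which splits off from
      -- `G`; the cofactor inherits the hypothesis on roots.
      have hFa := minpoly.eq_of_irreducible_of_monic hFirr (h a ha) hF
      obtain ⟨H, rfl⟩ : F ∣ G := hFa ▸ minpoly.dvd K a ha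
      have hH : H ≠ 0 := right_ne_zero_of_mul hG
      have hs := hFirr.natDegree_pos
      rw [natDegree_mul hFirr.ne_zero hH] at hN
      have := ih H.natDegree (by omega) hH (fun b hb => h b (by rw [map_mul, hb, mul_zero])) rfl
      rw [← hN]
      exact dvd_add dvd_rfl this

/-- If `F(Y) = 0` and the characteristic polynomial of `Y` has coefficients in `K`, then
the degree of the irreducible polynomial `F` divides the size of `Y`. -/
theorem natDegree_dvd_card_of_aeval_eq_zero {K L ι : Type*} [Field K] [Field L] [Algebra K L]
    [Fintype ι] [DecidableEq ι] {F : K[X]} (hF : F.Monic) (hFirr : Irreducible F)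
    {M : Matrix ι ι L} (hM : aeval M F = 0) {G : K[X]}
    (hG : G.map (algebraMap K L) = M.charpoly) : F.natDegree ∣ Fintype.card ι := by
  have hdeg : G.natDegree = Fintype.card ι := by
    rw [← natDegree_map (algebraMap K L), hG, Matrix.charpoly_natDegree_eq_dim]
  rw [← hdeg]
  refine natDegree_dvd_of_roots (Ω := AlgebraicClosure L) hF hFirr ?_ fun a ha => ?_
  · rintro rfl
    rw [Polynomial.map_zero] at hG
    exact M.charpoly_monic.ne_zero hG.symm
  · let Ω := AlgebraicClosure L
    change aeval (a : Ω) F = 0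
    change aeval (a : Ω) G = 0 at ha
    set MΩ : Matrix ι ι Ω := M.map (algebraMap L Ω) with hMΩ
    have h1 : MΩ.charpoly.IsRoot a := by
      rw [hMΩ, Matrix.charpoly_map, ← hG, Polynomial.map_map, ← IsScalarTower.algebraMap_eq,
        Polynomial.IsRoot, Polynomial.eval_map_algebraMap, ha]
    have h2 : aeval MΩ F = 0 := by
      have := congrArg ((Algebra.ofId L Ω).restrictScalars K).mapMatrix hM
      rwa [map_zero, ← aeval_algHom_apply] at this
    -- A root `a` is an eigenvalue; on an eigenvector `v` the relation `F(M) = 0` becomes `F(a) v =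
    -- 0`.
    rw [← Matrix.charpoly_toLin', ← Module.End.hasEigenvalue_iff_isRoot_charpoly] at h1
    obtain ⟨v, hv⟩ := h1.exists_hasEigenvector
    have h3 : aeval (Matrix.toLin' MΩ) (F.map (algebraMap K Ω)) = 0 := by
      have h4 : aeval MΩ (F.map (algebraMap K Ω)) = 0 := by rw [aeval_map_algebraMap, h2]
      have := congrArg (Matrix.toLinAlgEquiv' (R := Ω) (n := ι)) h4
      rwa [map_zero, ← AlgEquiv.coe_toAlgHom, ← aeval_algHom_apply] at this
    have h4 := Module.End.aeval_apply_of_hasEigenvector (p := F.map (algebraMap K Ω)) hv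
    rw [h3, LinearMap.zero_apply, eq_comm, smul_eq_zero] at h4
    have := h4.resolve_right hv.2
    rwa [Polynomial.eval_map_algebraMap] at this

namespace TwistedPoly

/-! ### The vector space `R / R f` over `L` -/

section Quotient

variable {K L : Type*} [Field K] [Field L] [Algebra K L] {σ : L ≃ₐ[K] L} {f : TwistedPoly σ}

instance instModuleQuotientModule (f : TwistedPoly σ) : Module L (QuotientModule f) :=
  Module.compHom _ (C σ)

theorem L_smul_def (a : L) (u : QuotientModule f) : a • u = C σ a • u := rfl

instance : IsScalarTower K L (QuotientModule f) where
  smul_assoc k a u := by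
    rw [L_smul_def, L_smul_def, Algebra.smul_def, map_mul, mul_smul, ← algebraMap_eq_C,
      algebraMap_smul]

theorem mkQ_eq_zero_iff {p : TwistedPoly σ} :
    (Ideal.span {f}).mkQ p = 0 ↔ p ∈ Ideal.span {f} :=
  Submodule.Quotient.mk_eq_zero _

theorem mkQ_self : (Ideal.span {f}).mkQ f = 0 :=
  mkQ_eq_zero_iff.2 (Ideal.mem_span_singleton_self f)

theorem remainder_mem (hf : f.Monic) (u : QuotientModule f) :
    remainder hf u ∈ degreeLT σ f.natDegree :=
  ((remainderEquiv hf).symm u).2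

theorem mk_remainder (hf : f.Monic) (u : QuotientModule f) :
    (Ideal.span {f}).mkQ (remainder hf u) = u :=
  (remainderEquiv hf).apply_symm_apply u

theorem remainder_smul (hf : f.Monic) (a : L) (u : QuotientModule f) :
    remainder hf (a • u) = C σ a * remainder hf u := by
  have h1 : a • u = (Ideal.span {f}).mkQ (C σ a * remainder hf u) := by
    rw [← smul_eq_mul, map_smul, mk_remainder]
    rfl
  rw [h1, remainder_mk]
  intro i hi
  rw [coeff_C_mul, remainder_mem hf u i hi, mul_zero]

/-- Coordinates on `R / R f`: the coefficients of the remainder. -/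
def coordEquiv (hf : f.Monic) : QuotientModule f ≃ₗ[L] (Fin f.natDegree → L) where
  toFun u i := (remainder hf u).coeff i
  map_add' u v := by
    ext i
    simp
  map_smul' a u := by
    ext i
    simp [remainder_smul, coeff_C_mul]
  invFun v := (Ideal.span {f}).mkQ (∑ i, C σ (v i) * X σ ^ (i : ℕ))
  left_inv u := by
    conv_rhs => rw [← mk_remainder hf u]
    refine congrArg (Ideal.span {f}).mkQ ?_
    ext j
    rw [coeff_sum]
    simp_rw [coeff_C_mul_X_pow]
    by_cases hj : j < f.natDegree
    · rw [Finset.sum_eq_single_of_mem ⟨j, hj⟩ (Finset.mem_univ _), if_pos rfl]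
      intro b _ hb
      rw [if_neg]
      rintro rfl
      exact hb rfl
    · rw [remainder_mem hf u j (not_lt.1 hj)]
      refine Finset.sum_eq_zero fun b _ => ?_
      rw [if_neg]
      have := b.2
      omega
  right_inv v := by
    ext j
    change (remainder hf _).coeff j = v j
    rw [remainder_mk]
    · rw [coeff_sum]
      simp_rw [coeff_C_mul_X_pow]
      rw [Finset.sum_eq_single_of_mem j (Finset.mem_univ _), if_pos rfl]
      intro b _ hb
      rw [if_neg]
      exact fun h => hb (Fin.ext h.symm)
    · intro i hi
      rw [coeff_sum]
      refine Finset.sum_eq_zero fun b _ => ?_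
      rw [coeff_C_mul_X_pow, if_neg]
      have := b.2
      omega

/-- The basis `1, x, …, x ^ (d - 1)` of `R / R f`. -/
def powBasis (hf : f.Monic) : Module.Basis (Fin f.natDegree) L (QuotientModule f) :=
  Module.Basis.ofEquivFun (coordEquiv hf)

theorem powBasis_repr (hf : f.Monic) (u : QuotientModule f) (i : Fin f.natDegree) :
    (powBasis hf).repr u i = (remainder hf u).coeff i := rfl

theorem powBasis_apply (hf : f.Monic) (j : Fin f.natDegree) :
    powBasis hf j = (Ideal.span {f}).mkQ (X σ ^ (j : ℕ)) := by
  apply (coordEquiv hf).injective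
  rw [powBasis, Module.Basis.coe_ofEquivFun, LinearEquiv.apply_symm_apply]
  ext i
  change _ = (remainder hf _).coeff i
  rw [remainder_mk, coeff_X_pow, Pi.single_apply]
  · simp only [Fin.ext_iff]
  · intro i hi
    rw [coeff_X_pow, if_neg (by omega)]

theorem finrank_quotientModule (hf : f.Monic) :
    Module.finrank L (QuotientModule f) = f.natDegree := by
  rw [Module.finrank_eq_card_basis (powBasis hf), Fintype.card_fin]

theorem finite_quotientModule [FiniteDimensional K L] (hf : f ≠ 0) :
    FiniteDimensional K (QuotientModule f) := by
  obtain ⟨g, hg, hgd, hfg⟩ := exists_monic hf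
  have h1 : FiniteDimensional K (QuotientModule g) := by
    have : FiniteDimensional L (QuotientModule g) := (powBasis hg).finiteDimensional_of_finite
    exact FiniteDimensional.trans K L _
  have h2 : Ideal.span {f} = Ideal.span {g} := by
    rw [hfg, span_C_mul (coeff_natDegree_ne_zero hf)]
  -- Quantifying over the ideal allows the equality of spans to be substituted inside the type of
  -- the quotient.
  have h3 : ∀ I : Ideal (TwistedPoly σ), I = Ideal.span {g} →
      FiniteDimensional K (TwistedPoly σ ⧸ I) := by
    rintro _ rfl
    exact h1
  exact h3 _ h2

theorem finrank_quotientModule_base (hf : f ≠ 0) :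
    Module.finrank K (QuotientModule f) = Module.finrank K L * f.natDegree := by
  obtain ⟨g, hg, hgd, hfg⟩ := exists_monic hf
  have h2 : Ideal.span {f} = Ideal.span {g} := by
    rw [hfg, span_C_mul (coeff_natDegree_ne_zero hf)]
  have h3 : ∀ I : Ideal (TwistedPoly σ), I = Ideal.span {g} →
      Module.finrank K (TwistedPoly σ ⧸ I) = Module.finrank K L * g.natDegree := by
    rintro _ rfl
    rw [← finrank_quotientModule hg, Module.finrank_mul_finrank]
  rw [← hgd]
  exact h3 _ h2

/-- Multiplication by `x` on `R / R f`, as a semilinear map. -/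
def mulX (f : TwistedPoly σ) : QuotientModule f →ₛₗ[(σ : L →+* L)] QuotientModule f where
  toFun u := X σ • u
  map_add' := smul_add _
  map_smul' a u := by
    rw [L_smul_def, L_smul_def, ← mul_smul, ← mul_smul, X_mul_C]
    rfl

theorem mulX_apply (u : QuotientModule f) : mulX f u = X σ • u := rfl

theorem remainder_mk_self_sub (hf : f.Monic) :
    remainder hf ((Ideal.span {f}).mkQ (X σ ^ f.natDegree)) = X σ ^ f.natDegree - f := by
  have h1 : (Ideal.span {f}).mkQ (X σ ^ f.natDegree) =
      (Ideal.span {f}).mkQ (X σ ^ f.natDegree - f) := by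
    rw [map_sub, mkQ_self, sub_zero]
  rw [h1, remainder_mk]
  intro i hi
  rw [coeff_sub, coeff_X_pow]
  rcases hi.eq_or_lt with rfl | hi
  · rw [if_pos rfl, show f.coeff f.natDegree = 1 from hf, sub_self]
  · rw [if_neg (by omega), coeff_eq_zero_of_natDegree_lt hi, sub_zero]

theorem semilinearMatrix_mulX (hf : f.Monic) (i j : Fin f.natDegree) :
    semilinearMatrix (powBasis hf) (mulX f) i j =
      if (j : ℕ) + 1 = f.natDegree then -f.coeff i else if (i : ℕ) = j + 1 then 1 else 0 := by
  rw [semilinearMatrix, Matrix.of_apply, powBasis_apply, mulX_apply, ← map_smul, smul_eq_mul,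
    ← pow_succ', powBasis_repr]
  split_ifs with hj hij
  · rw [hj, remainder_mk_self_sub, coeff_sub, coeff_X_pow, if_neg (by omega), zero_sub]
  · rw [remainder_mk, coeff_X_pow, if_pos hij]
    intro k hk
    rw [coeff_X_pow, if_neg (by omega)]
  · rw [remainder_mk, coeff_X_pow, if_neg hij]
    intro k hk
    rw [coeff_X_pow, if_neg (by omega)]

end Quotient

/-- The determinant of a companion matrix. -/
theorem _root_.Matrix.det_companion {R : Type*} [CommRing R] (d : ℕ) (c : Fin (d + 1) → R) :
    (Matrix.of fun i j : Fin (d + 1) => if (j : ℕ) + 1 = d + 1 then c i else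
      if (i : ℕ) = j + 1 then (1 : R) else 0).det = (-1) ^ d * c 0 := by
  -- Only the last entry of the top row can be nonzero, and its minor is the identity.
  rw [Matrix.det_succ_row_zero, Finset.sum_eq_single (Fin.last d)]
  · have h : (Matrix.of fun i j : Fin (d + 1) => if (j : ℕ) + 1 = d + 1 then c i else
        if (i : ℕ) = j + 1 then (1 : R) else 0).submatrix Fin.succ (Fin.last d).succAbove = 1 := by
      ext i j
      have := j.2
      simp [Matrix.one_apply, Fin.ext_iff, this.ne]
    rw [h]
    simp
  · intro j _ hj
    have : (j : ℕ) ≠ d := fun h => hj (Fin.ext h)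
    simp [this]
  · simp

/-! ### Norms of the constant coefficients of similar polynomials -/

section Norm

variable {K L : Type*} [Field K] [Field L] [Algebra K L] {σ : L ≃ₐ[K] L} {f g : TwistedPoly σ}

theorem det_semilinearMatrix_mulX (hf : f.Monic) {d : ℕ} (hd : f.natDegree = d + 1) :
    (semilinearMatrix (powBasis hf) (mulX f)).det = (-1) ^ (d + 1) * f.coeff 0 := by
  have h := Matrix.det_companion d fun i => -f.coeff i
  rw [← Matrix.det_reindex_self (finCongr hd)]
  rw [pow_succ, mul_assoc, neg_one_mul]
  refine Eq.trans (congrArg Matrix.det ?_) h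
  ext i j
  simp [semilinearMatrix_mulX, hd]

/-- The constant coefficients of similar monic polynomials have the same norm. -/
theorem norm_coeff_zero_eq [FiniteDimensional K L] (hf : f.Monic) (hg : g.Monic)
    (h0 : f.natDegree ≠ 0) (h : g.natDegree = f.natDegree)
    (e : QuotientModule g ≃ₗ[TwistedPoly σ] QuotientModule f) :
    Algebra.norm K (f.coeff 0) = Algebra.norm K (g.coeff 0) := by
  obtain ⟨d, hd⟩ := Nat.exists_eq_succ_of_ne_zero h0
  let eL : QuotientModule g ≃ₗ[L] QuotientModule f :=
    { e with map_smul' := fun a u => e.map_smul (C σ a) u }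
  let b : Module.Basis (Fin f.natDegree) L (QuotientModule f) :=
    ((powBasis hg).map eL).reindex (finCongr h)
  -- In the basis carried over from `R / R g`, multiplication by `x` has the companion matrix of
  -- `g`; only the norm of the determinant survives the comparison with the companion matrix of `f`.
  have h1 : (semilinearMatrix b (mulX f)).det =
      (semilinearMatrix (powBasis hg) (mulX g)).det := by
    rw [← Matrix.det_reindex_self (finCongr h)]
    congr 1
    ext i j
    simp only [semilinearMatrix, Matrix.of_apply, Matrix.reindex_apply, Matrix.submatrix_apply,
      b, Module.Basis.repr_reindex_apply, Module.Basis.reindex_apply, Module.Basis.map_apply,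
      Module.Basis.map_repr, LinearEquiv.trans_apply, mulX_apply]
    congr 2
    rw [LinearEquiv.symm_apply_eq]
    exact (e.map_smul (X σ) _).symm
  have h2 := norm_det_semilinearMatrix σ (powBasis hf) b (mulX f)
  rw [h1, det_semilinearMatrix_mulX hf hd, det_semilinearMatrix_mulX hg (h.trans hd), map_mul,
    map_mul] at h2
  exact mul_left_cancel₀ (Algebra.norm_ne_zero_iff.2 (by simp)) h2

end Norm

/-! ### The degrees of the irreducible factors of `F(x ^ n)` -/

section Degrees

variable {K L : Type*} [Field K] [Field L] [Algebra K L] {σ : L ≃ₐ[K] L} {f q : TwistedPoly σ}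

/-- The map sends the class of `1` to `v`, and the simple module `R / R f` is generated by any
nonzero element. -/
theorem exists_surjective_of_smul_eq_zero (hf : Irreducible f) {v : QuotientModule f}
    (hv : v ≠ 0) (hq : q • v = 0) :
    ∃ φ : QuotientModule q →ₗ[TwistedPoly σ] QuotientModule f, Function.Surjective φ := by
  have := isSimpleModule_quotient hf
  have h1 : Ideal.span {q} ≤ LinearMap.ker (LinearMap.toSpanSingleton (TwistedPoly σ) _ v) := by
    rw [Ideal.span_singleton_le_iff_mem]
    exact hq
  refine ⟨(Ideal.span {q}).liftQ _ h1, ?_⟩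
  rw [← LinearMap.range_eq_top, Submodule.range_liftQ, LinearMap.range_toSpanSingleton]
  exact IsSimpleModule.span_singleton_eq_top _ hv

variable [FiniteDimensional K L]

theorem natDegree_le_of_surjective (hf : f ≠ 0) (hq : q ≠ 0)
    {φ : QuotientModule q →ₗ[TwistedPoly σ] QuotientModule f} (hφ : Function.Surjective φ) :
    f.natDegree ≤ q.natDegree := by
  have := finite_quotientModule hq
  have h := LinearMap.finrank_le_finrank_of_surjective (f := φ.restrictScalars K) hφ
  rw [finrank_quotientModule_base hf, finrank_quotientModule_base hq] at h
  exact Nat.le_of_mul_le_mul_left h Module.finrank_pos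

theorem injective_of_surjective (hf : f ≠ 0) (hq : q ≠ 0) (hd : q.natDegree = f.natDegree)
    {φ : QuotientModule q →ₗ[TwistedPoly σ] QuotientModule f} (hφ : Function.Surjective φ) :
    Function.Injective φ := by
  have := finite_quotientModule hq
  have := finite_quotientModule hf
  refine (LinearMap.injective_iff_surjective_of_finrank_eq_finrank
    (f := φ.restrictScalars K) ?_).2 hφ
  rw [finrank_quotientModule_base hf, finrank_quotientModule_base hq, hd]

variable [IsGalois K L] {F : K[X]}

theorem central_smul_eq_zero (hfF : central σ F ∈ Ideal.span {f}) (u : QuotientModule f) :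
    central σ F • u = 0 := by
  obtain ⟨p, rfl⟩ := (Ideal.span {f}).mkQ_surjective u
  rw [← map_smul, smul_eq_mul, central_commute]
  exact mkQ_eq_zero_iff.2 (Ideal.mul_mem_left _ _ hfF)

theorem smul_eq_zero_of_mem_span_central (hfF : central σ F ∈ Ideal.span {f}) {p : TwistedPoly σ}
    (hp : p ∈ Ideal.span {central σ F}) (u : QuotientModule f) : p • u = 0 := by
  obtain ⟨c, rfl⟩ := Ideal.mem_span_singleton'.1 hp
  rw [mul_smul, central_smul_eq_zero hfF, smul_zero]

variable (hF : F.Monic) (hFirr : Irreducible F) (hFX : F ≠ Polynomial.X)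

include hF hFirr hFX in
theorem X_smul_injective (hfF : central σ F ∈ Ideal.span {f}) :
    Function.Injective fun u : QuotientModule f => X σ • u := by
  obtain ⟨t, ht, -⟩ := exists_inv_X (σ := σ) hF hFirr hFX
  have h1 : ∀ u : QuotientModule f, t • X σ • u = u := fun u => by
    rw [← sub_eq_zero, ← mul_smul]
    nth_rewrite 2 [← one_smul (TwistedPoly σ) u]
    rw [← sub_smul]
    exact smul_eq_zero_of_mem_span_central hfF ht u
  intro u v h
  rw [← h1 u, ← h1 v]
  exact congrArg _ h

include hF hFirr hFX in
theorem coeff_zero_ne_zero (hf : f.Monic) (hfF : central σ F ∈ Ideal.span {f}) :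
    f.coeff 0 ≠ 0 := by
  intro h0
  obtain ⟨p, hp, hpd⟩ := X_mul_eq_of_coeff_zero h0
  have h1 : X σ • (Ideal.span {f}).mkQ p = X σ • 0 := by
    rw [← map_smul, smul_eq_mul, ← hp, mkQ_self, smul_zero]
  have h2 := mkQ_eq_zero_iff.1 (X_smul_injective hF hFirr hFX hfF h1)
  have h3 := eq_zero_of_mem_span hf (hpd _ (mem_degreeLT_natDegree f)) h2
  rw [h3, mul_zero] at hp
  exact hf.ne_zero hp

/-- The action of `x ^ n` on `R / R f`, which is linear over `L`. -/
def mulXPow (f : TwistedPoly σ) : QuotientModule f →ₗ[L] QuotientModule f where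
  toFun u := X σ ^ Module.finrank K L • u
  map_add' := smul_add _
  map_smul' a u := by
    rw [L_smul_def, RingHom.id_apply, L_smul_def, ← mul_smul, ← mul_smul, X_pow_mul_C,
      pow_finrank_eq_one]
    rfl

theorem aeval_mulXPow (G : K[X]) (u : QuotientModule f) :
    aeval (mulXPow f) G u = central σ G • u := by
  have hpow : ∀ (k : ℕ) (u : QuotientModule f),
      (mulXPow f ^ k) u = (X σ ^ Module.finrank K L) ^ k • u := by
    intro k
    induction k with
    | zero => simp
    | succ k ih =>
      intro u
      rw [pow_succ, Module.End.mul_apply, ih, pow_succ, mul_smul]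
      rfl
  induction G using Polynomial.induction_on' with
  | add p q hp hq =>
    rw [map_add, LinearMap.add_apply, hp, hq, ← add_smul, central, central, central, map_add]
  | monomial k a =>
    rw [aeval_monomial, central, aeval_monomial, Module.End.mul_apply, hpow, mul_smul,
      algebraMap_smul, Module.algebraMap_end_apply]

include hF hFirr hFX in
-- Since `σ ^ n = 1`, `x ^ n` acts `L`-linearly, and it commutes with the semilinear action of `x`.
-- The latter is invertible as `f₀ ≠ 0`, so the characteristic polynomial of `x ^ n` is fixed by `σ`
-- and descends to `K`; its roots are roots of `F`.
theorem natDegree_dvd_natDegree (hσ : Subgroup.zpowers σ = ⊤) (hf : f.Monic)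
    (hfu : f.natDegree ≠ 0) (hfF : central σ F ∈ Ideal.span {f}) :
    F.natDegree ∣ f.natDegree := by
  set b := powBasis hf
  obtain ⟨d, hd⟩ := Nat.exists_eq_succ_of_ne_zero hfu
  have hmap := charpoly_map_of_commute_semilinear b (mulX f) (mulXPow f) (fun v => by
    change X σ • X σ ^ Module.finrank K L • v = X σ ^ Module.finrank K L • X σ • v
    rw [← mul_smul, ← mul_smul, ← pow_succ', ← pow_succ]) (by
      rw [det_semilinearMatrix_mulX hf hd]
      exact mul_ne_zero (by simp) (coeff_zero_ne_zero hF hFirr hFX hf hfF))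
  have hlift : (LinearMap.toMatrix b b (mulXPow f)).charpoly ∈ lifts (algebraMap K L) := by
    rw [lifts_iff_coeff_lifts]
    intro i
    have h1 := congrArg (fun p => p.coeff i) hmap
    rw [Polynomial.coeff_map] at h1
    exact mem_range_of_fixed hσ h1
  obtain ⟨G, hG⟩ := (mem_lifts _).1 hlift
  have h := natDegree_dvd_card_of_aeval_eq_zero hF hFirr ?_ hG
  · rwa [Fintype.card_fin] at h
  · have h0 : aeval (mulXPow f) F = 0 := LinearMap.ext fun u => by
      rw [aeval_mulXPow, central_smul_eq_zero hfF, LinearMap.zero_apply]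
    have h1 := congrArg ((LinearMap.toMatrixAlgEquiv b).toAlgHom.restrictScalars K) h0
    rw [map_zero, ← aeval_algHom_apply] at h1
    exact h1

include hF hFirr hFX in
-- It suffices that `q` kills a nonzero class of `R / R f`: the resulting surjection between simple
-- modules is an isomorphism, and dimensions give the degrees.
theorem natDegree_eq_of_irreducible_factor (hσ : Subgroup.zpowers σ = ⊤) (hf : Irreducible f)
    (hfF : central σ F ∈ Ideal.span {f}) (hq : Irreducible q) {g : TwistedPoly σ}
    (hg : g * q = central σ F) : q.natDegree = f.natDegree := by
  have := finite_quotientModule (K := K) hf.ne_zero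
  have hF0 := (monic_central (σ := σ) hF).ne_zero
  obtain ⟨v, hv, hqv⟩ : ∃ v : QuotientModule f, v ≠ 0 ∧ q • v = 0 := by
    by_contra! hinj
    -- Multiplication by `q` is linear over the central field `K`, though not in general over `L`.
    -- If it is injective it is surjective, and then `g q = F(x ^ n)` makes `g` act as zero, so
    -- faithfulness gives `g = F(x ^ n) h = g q h` and `q` is a unit.
    let ψ : QuotientModule f →ₗ[K] QuotientModule f :=
      { toFun := fun u => q • u
        map_add' := smul_add _
        map_smul' := fun k u => by
          rw [RingHom.id_apply, ← algebraMap_smul (TwistedPoly σ) k u,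
            ← algebraMap_smul (TwistedPoly σ) k (q • u), ← mul_smul, ← mul_smul,
            Algebra.commutes] }
    have hψ : Function.Injective ψ := by
      rw [← LinearMap.ker_eq_bot, LinearMap.ker_eq_bot']
      intro u hu
      by_contra h
      exact hinj u h hu
    have hψs := LinearMap.injective_iff_surjective.1 hψ
    have hgv : ∀ u : QuotientModule f, g • u = 0 := by
      intro u
      obtain ⟨w, rfl⟩ := hψs u
      change g • q • w = 0
      rw [← mul_smul, hg, central_smul_eq_zero hfF]
    obtain ⟨h, hh⟩ := Ideal.mem_span_singleton'.1
      (mem_span_central_of_annihilates hσ hF hFirr hFX hf.not_isUnit hfF hgv)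
    refine hq.not_isUnit (IsUnit.of_mul_eq_one_right h ?_)
    rw [← central_commute, ← hg, mul_assoc] at hh
    have h3 : q * h = 1 := mul_left_cancel₀ (left_ne_zero_of_mul (hg ▸ hF0))
      (hh.trans (mul_one g).symm)
    refine mul_left_cancel₀ hq.ne_zero ?_
    rw [← mul_assoc, h3, one_mul, mul_one]
  obtain ⟨φ, hφ⟩ := exists_surjective_of_smul_eq_zero hf hv hqv
  refine le_antisymm ?_ (natDegree_le_of_surjective hf.ne_zero hq.ne_zero hφ)
  have := isSimpleModule_quotient hf
  have := isSimpleModule_quotient hq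
  have hbij := (LinearMap.bijective_or_eq_zero φ).resolve_right fun h0 => by
    obtain ⟨w, hw⟩ := hφ v
    rw [h0] at hw
    exact hv hw.symm
  exact natDegree_le_of_surjective hq.ne_zero hf.ne_zero
    (φ := (LinearEquiv.ofBijective φ hbij).symm.toLinearMap)
    (LinearEquiv.ofBijective φ hbij).symm.surjective

omit [IsGalois K L] [FiniteDimensional K L] in
theorem natDegree_list_prod {d : ℕ} (l : List (TwistedPoly σ))
    (hl : ∀ q ∈ l, q ≠ 0 ∧ q.natDegree = d) : l.prod ≠ 0 ∧ l.prod.natDegree = l.length * d := by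
  induction l with
  | nil => exact ⟨one_ne_zero, by rw [List.prod_nil, ← map_one (C σ), natDegree_C]; simp⟩
  | cons p l ih =>
    have h1 := hl p List.mem_cons_self
    have h2 := ih fun q hq => hl q (List.mem_cons_of_mem _ hq)
    rw [List.prod_cons]
    refine ⟨mul_ne_zero h1.1 h2.1, ?_⟩
    rw [natDegree_mul h1.1 h2.1, h1.2, h2.2, List.length_cons]
    ring

include hF hFirr hFX in
/-- If `F(x ^ n)` is a product of `m` irreducible factors, then each has degree `s n / m`. -/
theorem mul_natDegree_eq (hσ : Subgroup.zpowers σ = ⊤) (hf : Irreducible f)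
    (hfF : central σ F ∈ Ideal.span {f}) {m : ℕ} (hm : IsProductOfIrreducibles (central σ F) m) :
    m * f.natDegree = F.natDegree * Module.finrank K L := by
  obtain ⟨l, rfl, hirr, hprod⟩ := hm
  rw [← natDegree_central (σ := σ) hF, ← hprod]
  refine (natDegree_list_prod l fun q hq => ⟨(hirr q hq).ne_zero, ?_⟩).2.symm
  obtain ⟨l₁, l₂, rfl⟩ := List.append_of_mem hq
  rw [List.prod_append, List.prod_cons] at hprod
  have hF0 := (monic_central (σ := σ) hF).ne_zero
  -- Because the product is central, its factors may be rotated cyclically until `q` stands last.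
  refine natDegree_eq_of_irreducible_factor hF hFirr hFX hσ hf hfF (hirr q hq)
    (g := l₂.prod * l₁.prod) ?_
  have h2 : l₂.prod ≠ 0 := by
    intro h0
    rw [h0, mul_zero, mul_zero] at hprod
    exact hF0 hprod.symm
  refine mul_right_cancel₀ h2 ?_
  rw [central_commute, ← hprod]
  simp only [mul_assoc]

include hF hFirr hFX in
-- Writing `deg f = s j`, the relation `m deg f = s n` becomes `m j = n`, so the integer division is
-- exact.
theorem natDegree_eq_mul_div (hσ : Subgroup.zpowers σ = ⊤) (hf : f.Monic) (hfirr : Irreducible f)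
    (hfF : central σ F ∈ Ideal.span {f}) {m : ℕ} (hm : IsProductOfIrreducibles (central σ F) m) :
    f.natDegree = F.natDegree * (Module.finrank K L / m) := by
  have h1 := mul_natDegree_eq hF hFirr hFX hσ hfirr hfF hm
  have h0 : f.natDegree ≠ 0 := fun h => hfirr.not_isUnit (isUnit_iff.2 ⟨hf.ne_zero, h⟩)
  obtain ⟨j, hj⟩ := natDegree_dvd_natDegree hF hFirr hFX hσ hf h0 hfF
  have hs := hFirr.natDegree_pos
  have hn := Module.finrank_pos (R := K) (M := L)
  have h2 : m * j = Module.finrank K L := by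
    refine Nat.eq_of_mul_eq_mul_left hs ?_
    rw [← h1, hj]
    ring
  have hm0 : 0 < m := by
    rcases Nat.eq_zero_or_pos m with rfl | h
    · omega
    · exact h
  rw [hj, ← h2, Nat.mul_div_cancel_left _ hm0]

include hF hFirr hFX in
-- With a single factor, `f` would be monic of the same degree as its multiple `F(x ^ n)`, hence
-- equal to it and central.
theorem two_le_of_notMem_center (hσ : Subgroup.zpowers σ = ⊤) (hf : f.Monic)
    (hfirr : Irreducible f) (hfF : central σ F ∈ Ideal.span {f})
    (hfc : f ∉ Set.center (TwistedPoly σ)) {m : ℕ}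
    (hm : IsProductOfIrreducibles (central σ F) m) : 2 ≤ m := by
  have h1 := mul_natDegree_eq hF hFirr hFX hσ hfirr hfF hm
  have hpos := Nat.mul_pos hFirr.natDegree_pos (Module.finrank_pos (R := K) (M := L))
  by_contra! hlt
  interval_cases m
  · omega
  · rw [one_mul, ← natDegree_central (σ := σ) hF] at h1
    have h2 := eq_C_mul_of_mem_span hf (h1 ▸ mem_degreeLT_natDegree (central σ F)) hfF
    rw [h1, show (central σ F).coeff _ = 1 from monic_central hF, map_one, one_mul] at h2
    refine hfc (h2 ▸ Semigroup.mem_center_iff.2 fun p => ?_)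
    exact (central_commute F p).symm

end Degrees

end TwistedPoly

/-! ### Tools for algebra isomorphisms -/

theorem IsoAsAlgebras.symm {k A B : Type*} [CommRing k] [NonUnitalNonAssocRing A]
    [NonUnitalNonAssocRing B] [Module k A] [Module k B] (h : IsoAsAlgebras k A B) :
    IsoAsAlgebras k B A := by
  obtain ⟨e, he⟩ := h
  refine ⟨e.symm, fun x y => ?_⟩
  rw [LinearEquiv.symm_apply_eq, he, e.apply_symm_apply, e.apply_symm_apply]

theorem IsoAsAlgebras.of_range {k A B : Type*} [CommRing k] [NonUnitalNonAssocRing A]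
    [NonUnitalNonAssocRing B] [Module k A] [Module k B] [IsScalarTower k A A]
    [SMulCommClass k A A] (N : NonUnitalSubalgebra k A)
    (T : B →ₗ[k] A) (hT : Function.Injective T) (hmul : ∀ x y, T (x * y) = T x * T y)
    (hN : ∀ a, a ∈ N ↔ ∃ b, T b = a) : IsoAsAlgebras k N B := by
  refine IsoAsAlgebras.symm ⟨LinearEquiv.ofBijective
    (T.codRestrict N.toSubmodule fun b => (hN _).2 ⟨b, rfl⟩) ⟨fun x y h => ?_, fun a => ?_⟩,
    fun x y => ?_⟩
  · exact hT (congrArg Subtype.val h)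
  · obtain ⟨b, hb⟩ := (hN _).1 a.2
    exact ⟨b, Subtype.ext hb⟩
  · exact Subtype.ext (hmul x y)

namespace TwistedPoly

namespace TwistedAlgebra

/-! ### Left multiplications of the algebra -/

section Spread

variable {K L : Type*} [Field K] [Field L] [Algebra K L] {σ : L ≃ₐ[K] L}
  [FiniteDimensional K L] (ρ : L ≃+* L) [FiniteDimensional (fixedBase K ρ) K]
  {f : TwistedPoly σ} (hf : f.Monic) {η : L}
  (hη : Algebra.norm (fixedBase K ρ) (η * f.coeff 0) ≠ 1) (z : K[X]) (s : ℕ)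

instance : Module (TwistedPoly σ) (TwistedAlgebra ρ hf hη z s) :=
  inferInstanceAs (Module (TwistedPoly σ) (QuotientModule f))

instance : FiniteDimensional (fixedBase K ρ) (TwistedAlgebra ρ hf hη z s) :=
  haveI : FiniteDimensional K (QuotientModule f) := finite_quotientModule hf.ne_zero
  FiniteDimensional.trans (fixedBase K ρ) K (QuotientModule f)

/-- The polynomial that represents the left multiplication by an element, up to a power of `x`. -/
def spread : TwistedAlgebra ρ hf hη z s →ₗ[fixedBase K ρ] TwistedPoly σ :=
  (spreadMap ρ hf hη).comp (ofQuotient ρ hf hη z s).symm.toLinearMap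

variable (σ) in
/-- A polynomial that acts on `R / R f` as the inverse of `x`. -/
def invX : TwistedPoly σ := central σ z * X σ ^ (s * Module.finrank K L - 1)

variable {ρ hf hη z s}

theorem mul_eq (a b : TwistedAlgebra ρ hf hη z s) :
    a * b = spread ρ hf hη z s a • invX σ z s • b :=
  mul_smul (spread ρ hf hη z s a) (invX σ z s) b

theorem smul_mk (p q : TwistedPoly σ) : p • mk ρ hf hη z s q = mk ρ hf hη z s (p * q) := rfl

theorem smul_mk_one (p : TwistedPoly σ) : p • mk ρ hf hη z s 1 = mk ρ hf hη z s p := by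
  rw [smul_mk, mul_one]

omit [FiniteDimensional K L] [FiniteDimensional (fixedBase K ρ) K] in
theorem mk_eq_mk_iff {p q : TwistedPoly σ} :
    mk ρ hf hη z s p = mk ρ hf hη z s q ↔ p - q ∈ Ideal.span {f} :=
  Submodule.Quotient.eq _

theorem mk_eq_zero_iff {p : TwistedPoly σ} :
    mk ρ hf hη z s p = 0 ↔ p ∈ Ideal.span {f} :=
  Submodule.Quotient.mk_eq_zero _

omit [FiniteDimensional K L] [FiniteDimensional (fixedBase K ρ) K] in
theorem mk_surjective : Function.Surjective (mk ρ hf hη z s) :=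
  (Ideal.span {f}).mkQ_surjective

/-- The remainder of `p` is `p - η ρ(p₀) f`, so adding `η ρ(p₀) f` restores `p`. Hence the
representing polynomials are precisely those defining the code with `d = deg f`. -/
theorem spread_mk {p : TwistedPoly σ} (hp : p ∈ twistedPolys σ ρ η f.natDegree) :
    spread ρ hf hη z s (mk ρ hf hη z s p) = p := by
  set r := p - C σ (η * ρ (p.coeff 0)) * f with hr
  have h1 : r ∈ degreeLT σ f.natDegree := by
    intro i hi
    rw [hr, coeff_sub, coeff_C_mul]
    rcases hi.eq_or_lt with rfl | hi
    · rw [hp.2, show f.coeff f.natDegree = 1 from hf, mul_one, sub_self]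
    · rw [hp.1 i hi, coeff_eq_zero_of_natDegree_lt hi, mul_zero, sub_zero]
  have h2 : r.coeff 0 = p.coeff 0 - η * ρ (p.coeff 0) * f.coeff 0 := by
    rw [hr, coeff_sub, coeff_C_mul]
  have h3 : mk ρ hf hη z s p = mk ρ hf hη z s r := by
    rw [mk_eq_mk_iff, hr, sub_sub_cancel]
    exact Ideal.mul_mem_left _ _ (Ideal.mem_span_singleton_self f)
  rw [h3]
  refine (spreadMap_apply ρ hf hη _ h1 h2).trans ?_
  rw [hr, sub_add_cancel]

theorem exists_mk_eq (a : TwistedAlgebra ρ hf hη z s) :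
    ∃ p ∈ twistedPolys σ ρ η f.natDegree, mk ρ hf hη z s p = a := by
  obtain ⟨a₀, ha₀⟩ := (tauEquiv ρ η (f.coeff 0) hη).surjective ((remainder hf a).coeff 0)
  have h0 : a₀ - η * ρ a₀ * f.coeff 0 = (remainder hf a).coeff 0 := by
    rw [← ha₀, ← tau_apply (K := K)]
    rfl
  refine ⟨remainder hf a + C σ (η * ρ a₀) * f, ⟨fun i hi => ?_, ?_⟩, ?_⟩
  · rw [coeff_add, remainder_mem hf a i hi.le, coeff_C_mul, coeff_eq_zero_of_natDegree_lt hi,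
      mul_zero, add_zero]
  · rw [coeff_add, remainder_mem hf a _ le_rfl, coeff_C_mul, coeff_add, coeff_C_mul, ← h0,
      show f.coeff f.natDegree = 1 from hf, mul_one, zero_add, sub_add_cancel]
  · refine Eq.trans ?_ (mk_remainder hf a)
    refine mk_eq_mk_iff.2 ?_
    rw [add_sub_cancel_left]
    exact Ideal.mul_mem_left _ _ (Ideal.mem_span_singleton_self f)

theorem spread_mem (a : TwistedAlgebra ρ hf hη z s) :
    spread ρ hf hη z s a ∈ twistedPolys σ ρ η f.natDegree := by
  obtain ⟨p, hp, rfl⟩ := exists_mk_eq a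
  rwa [spread_mk hp]

theorem mk_spread (a : TwistedAlgebra ρ hf hη z s) :
    mk ρ hf hη z s (spread ρ hf hη z s a) = a := by
  obtain ⟨p, hp, rfl⟩ := exists_mk_eq a
  rw [spread_mk hp]

end Spread

/-! ### Unity and the action of the inverse of `x` -/

section Structure

variable {K L : Type*} [Field K] [Field L] [Algebra K L] {σ : L ≃ₐ[K] L}
  [FiniteDimensional K L] [IsGalois K L] {ρ : L ≃+* L} [FiniteDimensional (fixedBase K ρ) K]
  {f : TwistedPoly σ} {hf : f.Monic} {η : L}
  {hη : Algebra.norm (fixedBase K ρ) (η * f.coeff 0) ≠ 1} {z : K[X]} {s : ℕ}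

section Inverse

variable (hs : 0 < s)
  (hz : central σ z * X σ ^ (s * Module.finrank K L) - 1 ∈ Ideal.span {f})

include hz in
-- The congruence is assumed for the class of `1` only; it extends to every class because `z(x ^ n)
-- x ^ (s n)` is central.
theorem central_mul_X_pow_smul (a : TwistedAlgebra ρ hf hη z s) :
    (central σ z * X σ ^ (s * Module.finrank K L)) • a = a := by
  obtain ⟨p, rfl⟩ := mk_surjective a
  have h1 : central σ z * X σ ^ (s * Module.finrank K L) = central σ (z * Polynomial.X ^ s) := by
    simp only [central, map_mul, map_pow, aeval_X]
    rw [← pow_mul, mul_comm s]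
  rw [smul_mk, mk_eq_mk_iff, h1, central_commute, ← h1]
  nth_rewrite 2 [← mul_one p]
  rw [← mul_sub]
  exact Ideal.mul_mem_left _ _ hz

include hs hz

theorem invX_smul_X_smul (a : TwistedAlgebra ρ hf hη z s) : invX σ z s • X σ • a = a := by
  rw [← mul_smul, invX, mul_assoc, ← pow_succ,
    Nat.sub_add_cancel (Nat.mul_pos hs Module.finrank_pos)]
  exact central_mul_X_pow_smul hz a

theorem X_smul_invX_smul (a : TwistedAlgebra ρ hf hη z s) : X σ • invX σ z s • a = a := by
  rw [← mul_smul, invX, ← mul_assoc, ← central_commute, mul_assoc, ← pow_succ',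
    Nat.sub_add_cancel (Nat.mul_pos hs Module.finrank_pos)]
  exact central_mul_X_pow_smul hz a

theorem mk_C_mul_X_mul (hd : 1 < f.natDegree) (α : L) (a : TwistedAlgebra ρ hf hη z s) :
    mk ρ hf hη z s (C σ α * X σ) * a = C σ α • a := by
  have h1 := C_mul_X_pow_mem_twistedPolys (σ := σ) (ρ := ρ) (η := η) α one_ne_zero hd
  rw [pow_one] at h1
  rw [mul_eq, spread_mk h1, mul_smul, X_smul_invX_smul hs hz]

theorem mk_X_sq_mul (hd : 2 < f.natDegree) (a : TwistedAlgebra ρ hf hη z s) :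
    mk ρ hf hη z s (X σ ^ 2) * a = X σ • a := by
  rw [mul_eq, spread_mk (X_pow_mem_twistedPolys two_ne_zero hd), pow_two, mul_smul,
    X_smul_invX_smul hs hz]

theorem mk_X_mul (hd : 1 < f.natDegree) (a : TwistedAlgebra ρ hf hη z s) :
    mk ρ hf hη z s (X σ) * a = a := by
  simpa using mk_C_mul_X_mul hs hz hd 1 a

theorem mul_mk_X (a : TwistedAlgebra ρ hf hη z s) : a * mk ρ hf hη z s (X σ) = a := by
  rw [mul_eq, ← smul_mk_one (X σ), invX_smul_X_smul hs hz, smul_mk_one, mk_spread]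

end Inverse

/-! ### The division property -/

/-- A nonzero polynomial `a₀ + ⋯ + η ρ(a₀) x ^ d` acts injectively on `R / R f`. -/
theorem eq_zero_of_spread_smul (hfirr : Irreducible f) {a v : TwistedAlgebra ρ hf hη z s}
    (hv : v ≠ 0) (h : spread ρ hf hη z s a • v = 0) : a = 0 := by
  by_contra ha
  set p := spread ρ hf hη z s a with hp
  have hp0 : p ≠ 0 := by
    intro h0
    have := mk_spread a
    rw [← hp, h0] at this
    exact ha (this.symm.trans (mk_eq_zero_iff.2 (zero_mem _)))
  have hpmem : p ∈ twistedPolys σ ρ η f.natDegree := spread_mem a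
  have hpd : p ∈ degreeLT σ (f.natDegree + 1) := fun i hi => hpmem.1 i hi
  obtain ⟨φ, hφ⟩ := exists_surjective_of_smul_eq_zero (q := p) hfirr (v := v) hv h
  have hdeg : p.natDegree = f.natDegree :=
    le_antisymm (Nat.lt_succ_iff.1 (natDegree_lt_of_mem hp0 hpd))
      (natDegree_le_of_surjective hfirr.ne_zero hp0 hφ)
  have hinj := injective_of_surjective hfirr.ne_zero hp0 hdeg hφ
  obtain ⟨q, hq, hqd, hpq⟩ := exists_monic hp0
  have hc0 := coeff_natDegree_ne_zero hp0
  set c := p.coeff p.natDegree with hc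
  have hspan : Ideal.span {q} = Ideal.span {p} := by rw [hpq, span_C_mul hc0]
  have e : QuotientModule q ≃ₗ[TwistedPoly σ] QuotientModule f :=
    (Submodule.quotEquivOfEq _ _ hspan).trans (LinearEquiv.ofBijective φ ⟨hinj, hφ⟩)
  have hd0 : f.natDegree ≠ 0 := fun h => hfirr.not_isUnit (isUnit_iff.2 ⟨hf.ne_zero, h⟩)
  have hnorm := norm_coeff_zero_eq hf hq hd0 (hqd.trans hdeg) e
  have : FiniteDimensional (fixedBase K ρ) L := FiniteDimensional.trans _ K L
  have hnorm' : Algebra.norm (fixedBase K ρ) (f.coeff 0) =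
      Algebra.norm (fixedBase K ρ) (q.coeff 0) := by
    rw [← Algebra.norm_norm (S := K), hnorm, Algebra.norm_norm]
  -- Here `p = c q` with `q` monic and similar to `f`, and the top coefficient of `p` is `η ρ(p₀)`.
  -- Taking norms to `K'` and cancelling `N(c)` yields `N(η f₀) = 1`.
  have h1 : c = η * ρ (c * q.coeff 0) := by
    rw [← coeff_C_mul, ← hpq, ← hpmem.2, hc, hdeg]
  have h2 := congrArg (Algebra.norm (fixedBase K ρ)) h1
  have h3 : Algebra.norm (fixedBase K ρ) (ρ (c * q.coeff 0)) =
      Algebra.norm (fixedBase K ρ) (c * q.coeff 0) :=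
    Algebra.norm_eq_of_algEquiv (overBase K ρ) _
  rw [map_mul, h3, map_mul, ← hnorm', mul_left_comm, ← map_mul] at h2
  exact hη (mul_left_cancel₀ (Algebra.norm_ne_zero_iff.2 hc0) (h2.symm.trans (mul_one _).symm))

section Division

variable (hs : 0 < s)
  (hz : central σ z * X σ ^ (s * Module.finrank K L) - 1 ∈ Ideal.span {f})

include hs hz

theorem eq_zero_or_eq_zero_of_mul (hfirr : Irreducible f) {a b : TwistedAlgebra ρ hf hη z s}
    (h : a * b = 0) : a = 0 ∨ b = 0 := by
  by_cases hb : b = 0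
  · exact Or.inr hb
  · refine Or.inl (eq_zero_of_spread_smul hfirr (v := invX σ z s • b) (fun h0 => hb ?_) ?_)
    · rw [← X_smul_invX_smul hs hz b, h0, smul_zero]
    · rwa [← mul_eq]

theorem mul_left_bijective (hfirr : Irreducible f) {a : TwistedAlgebra ρ hf hη z s}
    (ha : a ≠ 0) : Function.Bijective (fun b => a * b) := by
  have hinj : Function.Injective (LinearMap.mulLeft (fixedBase K ρ) a) := by
    rw [← LinearMap.ker_eq_bot, LinearMap.ker_eq_bot']
    exact fun b hb => (eq_zero_or_eq_zero_of_mul hs hz hfirr hb).resolve_left ha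
  exact ⟨hinj, LinearMap.injective_iff_surjective.1 hinj⟩

theorem mul_right_bijective (hfirr : Irreducible f) {a : TwistedAlgebra ρ hf hη z s}
    (ha : a ≠ 0) : Function.Bijective (fun b => b * a) := by
  have hinj : Function.Injective (LinearMap.mulRight (fixedBase K ρ) a) := by
    rw [← LinearMap.ker_eq_bot, LinearMap.ker_eq_bot']
    exact fun b hb => (eq_zero_or_eq_zero_of_mul hs hz hfirr hb).resolve_right ha
  exact ⟨hinj, LinearMap.injective_iff_surjective.1 hinj⟩

end Division

end Structure

end TwistedAlgebra

variable {K L : Type*} [Field K] [Field L] [Algebra K L] {σ : L ≃ₐ[K] L}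

variable (σ) in
/-- The constants as an algebra homomorphism over `K'`. -/
def constHom (ρ : L ≃+* L) : L →ₐ[fixedBase K ρ] TwistedPoly σ where
  __ := C σ
  commutes' _ := rfl

theorem C_mul_mem_twistedPolys {ρ : L ≃+* L} {η : L} {d : ℕ} {α : L} (hα : ρ α = α)
    {p : TwistedPoly σ} (hp : p ∈ twistedPolys σ ρ η d) : C σ α * p ∈ twistedPolys σ ρ η d := by
  refine ⟨fun i hi => by rw [coeff_C_mul, hp.1 i hi, mul_zero], ?_⟩
  rw [coeff_C_mul, coeff_C_mul, hp.2, map_mul, hα]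
  ring

theorem mul_C_mem_twistedPolys {ρ : L ≃+* L} {η : L} {d : ℕ} {α : L} (hα : ρ α = (σ ^ d) α)
    {p : TwistedPoly σ} (hp : p ∈ twistedPolys σ ρ η d) : p * C σ α ∈ twistedPolys σ ρ η d := by
  refine ⟨fun i hi => by rw [coeff_mul_C, hp.1 i hi, zero_mul], ?_⟩
  rw [coeff_mul_C, coeff_mul_C, hp.2, map_mul, pow_zero, AlgEquiv.one_apply, hα]
  ring

namespace TwistedAlgebra

/-! ### The nuclei -/

variable [FiniteDimensional K L] [IsGalois K L] {ρ : L ≃+* L} [FiniteDimensional (fixedBase K ρ) K]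
  {f : TwistedPoly σ} {hf : f.Monic} {η : L}
  {hη : Algebra.norm (fixedBase K ρ) (η * f.coeff 0) ≠ 1} {z : K[X]} {s : ℕ}

variable (ρ hf hη z s) in
/-- Taking the class of a polynomial, as a linear map over `K'`. -/
def mkHom : TwistedPoly σ →ₗ[fixedBase K ρ] TwistedAlgebra ρ hf hη z s :=
  (ofQuotient ρ hf hη z s).toLinearMap.comp
    ((Ideal.span {f}).mkQ.restrictScalars (fixedBase K ρ))

variable (hs : 0 < s)
  (hz : central σ z * X σ ^ (s * Module.finrank K L) - 1 ∈ Ideal.span {f})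

include hs hz

/-- Right multiplication by the class of `x g` is `b ↦ B g`, with `B` the word of `b`. The two sides
of associativity differ by a multiple of `f` times `g`, which lies in `R f`. -/
theorem mem_rightNucleus_of_mul_mem {g : TwistedPoly σ} (hg : f * g ∈ Ideal.span {f}) :
    mk ρ hf hη z s (X σ * g) ∈ rightNucleus (fixedBase K ρ) (TwistedAlgebra ρ hf hη z s) := by
  have hmul : ∀ b : TwistedAlgebra ρ hf hη z s,
      b * mk ρ hf hη z s (X σ * g) = mk ρ hf hη z s (spread ρ hf hη z s b * g) := fun b => by
    rw [mul_eq, ← smul_mk (X σ), invX_smul_X_smul hs hz, smul_mk]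
  intro a b
  rw [hmul, hmul, mul_eq, smul_mk, smul_mk, mk_eq_mk_iff, ← mul_assoc, ← mul_assoc, ← sub_mul]
  have h1 : spread ρ hf hη z s a * invX σ z s * spread ρ hf hη z s b -
      spread ρ hf hη z s (a * b) ∈ Ideal.span {f} := by
    rw [← mk_eq_mk_iff (ρ := ρ) (hf := hf) (hη := hη) (z := z) (s := s), mk_spread, mul_assoc,
      ← smul_mk, ← smul_mk, mk_spread, ← mul_eq]
  obtain ⟨c, hc⟩ := Ideal.mem_span_singleton'.1 h1
  rw [← hc, mul_assoc]
  exact Ideal.mul_mem_left _ _ hg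

/-- Left multiplications by `α x` and `x ^ 2` are the actions of `α` and `x`, so right
multiplication by `c` is `R`-linear. It sends the class of `1` to `x⁻¹ c`, which `f` must therefore
kill. -/
theorem smul_invX_smul_eq_zero (hd : 2 < f.natDegree) {c : TwistedAlgebra ρ hf hη z s}
    (hc : c ∈ rightNucleus (fixedBase K ρ) (TwistedAlgebra ρ hf hη z s)) :
    f • invX σ z s • c = 0 := by
  have hC : ∀ (α : L) (b : TwistedAlgebra ρ hf hη z s), (C σ α • b) * c = C σ α • (b * c) :=
    fun α b => by
      rw [← mk_C_mul_X_mul hs hz (by omega), ← mk_C_mul_X_mul hs hz (by omega), hc]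
  have hX : ∀ b : TwistedAlgebra ρ hf hη z s, (X σ • b) * c = X σ • (b * c) := fun b => by
    rw [← mk_X_sq_mul hs hz hd, ← mk_X_sq_mul hs hz hd, hc]
  have hXn : ∀ (i : ℕ) (b : TwistedAlgebra ρ hf hη z s),
      (X σ ^ i • b) * c = X σ ^ i • (b * c) := fun i => by
    induction i with
    | zero => simp
    | succ i ih =>
      intro b
      rw [pow_succ, mul_smul, ih, hX, mul_smul]
  have hp : ∀ (p : TwistedPoly σ) (b : TwistedAlgebra ρ hf hη z s),
      (p • b) * c = p • (b * c) := fun p b => by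
    rw [eq_sum p, Finset.sum_smul, Finset.sum_mul, Finset.sum_smul]
    refine Finset.sum_congr rfl fun i _ => ?_
    rw [mul_smul, hC, hXn, mul_smul]
  have h1 : X σ • (mk ρ hf hη z s 1 * c) = c := by
    rw [← hp, smul_mk_one, mk_X_mul hs hz (by omega)]
  have h2 : mk ρ hf hη z s 1 * c = invX σ z s • c := by
    rw [← invX_smul_X_smul hs hz (mk ρ hf hη z s 1 * c), h1]
  rw [← h2, ← hp, smul_mk_one, mk_eq_zero_iff.2 (Ideal.mem_span_singleton_self f), zero_mul]

/-- The isomorphism is `c ↦ x⁻¹ c`; it preserves products because `x⁻¹ (c ⋆ c') = (x⁻¹ C) (x⁻¹ c')`,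
with `C` the word of `c`. -/
theorem rightNucleus_iso (hd : 2 < f.natDegree) :
    IsoAsAlgebras (fixedBase K ρ)
      (rightNucleus (fixedBase K ρ) (TwistedAlgebra ρ hf hη z s))
      (Eigenring (fixedBase K ρ) f) := by
  set N := rightNucleus (fixedBase K ρ) (TwistedAlgebra ρ hf hη z s)
  have hmk : ∀ c : TwistedAlgebra ρ hf hη z s,
      mk ρ hf hη z s (invX σ z s * spread ρ hf hη z s c) = invX σ z s • c := fun c => by
    rw [← smul_mk, mk_spread]
  let θ₀ : N →ₗ[fixedBase K ρ] elementIdealiser (fixedBase K ρ) f :=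
    LinearMap.codRestrict (Subalgebra.toSubmodule (elementIdealiser (fixedBase K ρ) f))
      ((LinearMap.mulLeft (fixedBase K ρ) (invX σ z s)).comp
        ((spread ρ hf hη z s).comp N.toSubmodule.subtype)) fun c => by
      change f * (invX σ z s * spread ρ hf hη z s c) ∈ Ideal.span {f}
      rw [← mk_eq_zero_iff (ρ := ρ) (hf := hf) (hη := hη) (z := z) (s := s), ← smul_mk, hmk]
      exact smul_invX_smul_eq_zero hs hz hd c.2
  have hθ₀ : ∀ c, (θ₀ c : TwistedPoly σ) = invX σ z s * spread ρ hf hη z s c := fun _ => rfl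
  have hmk' : ∀ u v : elementIdealiser (fixedBase K ρ) f,
      Ideal.Quotient.mk (idealInIdealiser (fixedBase K ρ) f) u = Ideal.Quotient.mk _ v ↔
      mk ρ hf hη z s u = mk ρ hf hη z s v := fun u v => by
    rw [Ideal.Quotient.eq, mk_eq_mk_iff]
    rfl
  let θ : N →ₗ[fixedBase K ρ] Eigenring (fixedBase K ρ) f :=
    (Ideal.Quotient.mkₐ (fixedBase K ρ) (idealInIdealiser (fixedBase K ρ) f)).toLinearMap.comp θ₀
  refine ⟨LinearEquiv.ofBijective θ ⟨fun c c' h => ?_, fun u => ?_⟩, fun c c' => ?_⟩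
  · have h1 := (hmk' _ _).1 h
    rw [hθ₀, hθ₀, hmk, hmk] at h1
    refine Subtype.ext ?_
    rw [← X_smul_invX_smul hs hz c.1, h1, X_smul_invX_smul hs hz]
  · obtain ⟨g, rfl⟩ := Ideal.Quotient.mk_surjective u
    refine ⟨⟨mk ρ hf hη z s (X σ * g), mem_rightNucleus_of_mul_mem hs hz g.2⟩, (hmk' _ _).2 ?_⟩
    rw [hθ₀, hmk]
    exact invX_smul_X_smul hs hz (mk ρ hf hη z s g)
  · refine ((hmk' (θ₀ (c * c')) (θ₀ c * θ₀ c')).2 ?_).trans (map_mul _ _ _)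
    rw [hθ₀, hmk]
    change _ = mk ρ hf hη z s ((θ₀ c : TwistedPoly σ) * (θ₀ c' : TwistedPoly σ))
    rw [hθ₀, hθ₀, ← smul_mk, hmk, mul_smul, ← mul_eq]
    rfl

section Nuclei

variable {F : K[X]} (hF : F.Monic) (hFirr : Irreducible F) (hFX : F ≠ Polynomial.X)
  (hfirr : Irreducible f) (hfF : central σ F ∈ Ideal.span {f}) (hσ : Subgroup.zpowers σ = ⊤)
  (hd : 2 < f.natDegree) (hdN : 2 * f.natDegree ≤ (central σ F).natDegree) (hη0 : η ≠ 0)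

include hF hFirr hFX hfirr hfF hσ

/-- Associativity for all `c` says that `A x⁻¹ B` and the word of `a ⋆ b` act equally on `R / R f`;
faithfulness turns this into a congruence modulo `F(x ^ n)`. -/
theorem mk_spread_mul_eq {a b : TwistedAlgebra ρ hf hη z s}
    (h : ∀ c, a * (b * c) = a * b * c) :
    Ideal.Quotient.mk (Ideal.span {central σ F})
      (spread ρ hf hη z s a * invX σ z s * spread ρ hf hη z s b) =
    Ideal.Quotient.mk _ (spread ρ hf hη z s (a * b)) := by
  rw [Ideal.Quotient.eq]
  have key : ∀ u : TwistedAlgebra ρ hf hη z s, (spread ρ hf hη z s a * invX σ z s *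
      spread ρ hf hη z s b - spread ρ hf hη z s (a * b)) • u = 0 := fun u => by
    rw [← invX_smul_X_smul hs hz u, sub_smul, mul_smul, mul_smul, ← mul_eq, ← mul_eq, ← mul_eq,
      h, sub_self]
  exact mem_span_central_of_annihilates hσ hF hFirr hFX hfirr.not_isUnit hfF key

include hd hdN hη0

/-- For `a` in the left nucleus, `A x⁻¹` maps each word `B` to the word of `a ⋆ b`, so it idealises
the code and is a constant fixed by `ρ`; applying it to the class of `x` recovers `a`. Conversely,
such a constant multiplies words to words. -/
theorem mem_leftNucleus_iff {a : TwistedAlgebra ρ hf hη z s} :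
    a ∈ leftNucleus (fixedBase K ρ) (TwistedAlgebra ρ hf hη z s) ↔
      ∃ α : L, ρ α = α ∧ mk ρ hf hη z s (C σ α * X σ) = a := by
  constructor
  · intro ha
    have h1 : Ideal.Quotient.mk (Ideal.span {central σ F})
        (spread ρ hf hη z s a * invX σ z s) ∈
        leftIdealiser (twistedCode σ ρ η F f.natDegree) := by
      intro u hu
      obtain ⟨c, hc, rfl⟩ := exists_of_mem_twistedCode hu
      rw [← map_mul, ← spread_mk (hf := hf) (hη := hη) (z := z) (s := s) hc,
        mk_spread_mul_eq hs hz hF hFirr hFX hfirr hfF hσ (fun v => ha _ v)]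
      exact mk_mem_twistedCode (spread_mem _)
    obtain ⟨α, hα, h2⟩ := (mem_leftIdealiser_iff hF hFirr hFX hd hdN hη0).1 h1
    refine ⟨α, hα, ?_⟩
    have h3 : (C σ α - spread ρ hf hη z s a * invX σ z s) •
        (mk ρ hf hη z s (X σ) : TwistedAlgebra ρ hf hη z s) = 0 :=
      smul_eq_zero_of_mem_span_central hfF (Ideal.Quotient.eq.1 h2) _
    rw [sub_smul, sub_eq_zero, mul_smul, ← mul_eq, mul_mk_X hs hz, smul_mk] at h3
    exact h3
  · rintro ⟨α, hα, rfl⟩ b c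
    rw [mk_C_mul_X_mul hs hz (by omega), mk_C_mul_X_mul hs hz (by omega)]
    have h1 : spread ρ hf hη z s (C σ α • b) = C σ α * spread ρ hf hη z s b := by
      rw [← spread_mk (hf := hf) (hη := hη) (z := z) (s := s)
        (C_mul_mem_twistedPolys hα (spread_mem b)), ← smul_mk, mk_spread]
    rw [mul_eq, mul_eq, h1, mul_smul]

/-- The same argument with `x⁻¹ B` acting on words from the right; here the class of `1` recovers
`b`. -/
theorem mem_middleNucleus_iff {b : TwistedAlgebra ρ hf hη z s} :
    b ∈ middleNucleus (fixedBase K ρ) (TwistedAlgebra ρ hf hη z s) ↔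
      ∃ β : L, ρ β = (σ ^ f.natDegree) β ∧ mk ρ hf hη z s (X σ * C σ β) = b := by
  constructor
  · intro hb
    have h1 : Ideal.Quotient.mk (Ideal.span {central σ F})
        (invX σ z s * spread ρ hf hη z s b) ∈
        rightIdealiser (twistedCode σ ρ η F f.natDegree) := by
      intro u hu
      obtain ⟨c, hc, rfl⟩ := exists_of_mem_twistedCode hu
      rw [← map_mul, ← mul_assoc, ← spread_mk (hf := hf) (hη := hη) (z := z) (s := s) hc,
        mk_spread_mul_eq hs hz hF hFirr hFX hfirr hfF hσ (fun v => hb _ v)]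
      exact mk_mem_twistedCode (spread_mem _)
    obtain ⟨β, hβ, h2⟩ := (mem_rightIdealiser_iff hF hFirr hFX hd hdN hη0).1 h1
    refine ⟨β, hβ, ?_⟩
    have h3 : (C σ β - invX σ z s * spread ρ hf hη z s b) •
        (mk ρ hf hη z s 1 : TwistedAlgebra ρ hf hη z s) = 0 :=
      smul_eq_zero_of_mem_span_central hfF (Ideal.Quotient.eq.1 h2) _
    rw [sub_smul, sub_eq_zero, mul_smul, smul_mk_one, smul_mk_one, mk_spread] at h3
    rw [← smul_mk, h3, X_smul_invX_smul hs hz]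
  · rintro ⟨β, hβ, rfl⟩ a c
    have h1 : spread ρ hf hη z s (mk ρ hf hη z s (X σ * C σ β)) = X σ * C σ β := by
      refine spread_mk ?_
      rw [X_mul_C]
      simpa using C_mul_X_pow_mem_twistedPolys (σ := σ) (ρ := ρ) (η := η) (σ β) one_ne_zero
        (by omega : 1 < f.natDegree)
    have h2 : a * mk ρ hf hη z s (X σ * C σ β) =
        mk ρ hf hη z s (spread ρ hf hη z s a * C σ β) := by
      rw [mul_eq, ← smul_mk (X σ), invX_smul_X_smul hs hz, smul_mk]
    rw [h2, mul_eq, mul_eq _ c, mul_eq _ c, h1, spread_mk (mul_C_mem_twistedPolys hβ (spread_mem a)),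
      mul_smul, invX_smul_X_smul hs hz, mul_smul]

theorem leftNucleus_iso :
    IsoAsAlgebras (fixedBase K ρ)
      (leftNucleus (fixedBase K ρ) (TwistedAlgebra ρ hf hη z s))
      (fixedElements (overBase K ρ)) := by
  let T : fixedElements (overBase K ρ) →ₗ[fixedBase K ρ] TwistedAlgebra ρ hf hη z s :=
    (mkHom ρ hf hη z s).comp ((LinearMap.mulRight (fixedBase K ρ) (X σ)).comp
      ((constHom σ ρ).comp (fixedElements (overBase K ρ)).val).toLinearMap)
  have hT : ∀ α, T α = mk ρ hf hη z s (C σ α * X σ) := fun _ => rfl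
  refine IsoAsAlgebras.of_range _ T ?_ (fun α β => ?_) fun a => ?_
  · intro α β h
    have h1 : ∀ γ : L, C σ γ * X σ ∈ twistedPolys σ ρ η f.natDegree := fun γ => by
      simpa using C_mul_X_pow_mem_twistedPolys (σ := σ) (ρ := ρ) (η := η) γ one_ne_zero
        (by omega : 1 < f.natDegree)
    have h2 := congrArg (spread ρ hf hη z s) h
    rw [hT, hT, spread_mk (h1 _), spread_mk (h1 _)] at h2
    exact Subtype.ext (C_injective (mul_right_cancel₀ X_ne_zero h2))
  · rw [hT, hT, hT, mk_C_mul_X_mul hs hz (by omega), smul_mk, ← mul_assoc, ← map_mul]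
    rfl
  · rw [mem_leftNucleus_iff hs hz hF hFirr hFX hfirr hfF hσ hd hdN hη0]
    exact ⟨fun ⟨α, hα, h⟩ => ⟨⟨α, hα⟩, h⟩, fun ⟨α, h⟩ => ⟨α, α.2, h⟩⟩

theorem middleNucleus_iso :
    IsoAsAlgebras (fixedBase K ρ)
      (middleNucleus (fixedBase K ρ) (TwistedAlgebra ρ hf hη z s))
      (fixedElements ((overBase K ρ)⁻¹ *
        (σ.restrictScalars (fixedBase K ρ)) ^ f.natDegree)) := by
  set S := fixedElements ((overBase K ρ)⁻¹ * (σ.restrictScalars (fixedBase K ρ)) ^ f.natDegree)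
  let T : S →ₗ[fixedBase K ρ] TwistedAlgebra ρ hf hη z s :=
    (mkHom ρ hf hη z s).comp ((LinearMap.mulLeft (fixedBase K ρ) (X σ)).comp
      ((constHom σ ρ).comp S.val).toLinearMap)
  have hT : ∀ α, T α = mk ρ hf hη z s (X σ * C σ α) := fun _ => rfl
  refine IsoAsAlgebras.of_range _ T ?_ (fun α β => ?_) fun a => ?_
  · intro α β h
    have h1 : ∀ γ : L, X σ * C σ γ ∈ twistedPolys σ ρ η f.natDegree := fun γ => by
      rw [X_mul_C]
      simpa using C_mul_X_pow_mem_twistedPolys (σ := σ) (ρ := ρ) (η := η) (σ γ) one_ne_zero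
        (by omega : 1 < f.natDegree)
    have h2 := congrArg (spread ρ hf hη z s) h
    rw [hT, hT, spread_mk (h1 _), spread_mk (h1 _)] at h2
    exact Subtype.ext (C_injective (mul_left_cancel₀ X_ne_zero h2))
  · rw [hT, hT, hT, X_mul_C (α : L), mk_C_mul_X_mul hs hz (by omega), smul_mk, ← mul_assoc,
      ← X_mul_C, mul_assoc, ← map_mul]
    rfl
  · rw [mem_middleNucleus_iff hs hz hF hFirr hFX hfirr hfF hσ hd hdN hη0]
    exact ⟨fun ⟨α, hα, h⟩ => ⟨⟨α, mem_fixedElements_inv_mul.2 hα⟩, h⟩,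
      fun ⟨α, h⟩ => ⟨α, mem_fixedElements_inv_mul.1 α.2, h⟩⟩

theorem nonassocCentre_iso :
    IsoAsAlgebras (fixedBase K ρ)
      (nonassocCentre (fixedBase K ρ) (TwistedAlgebra ρ hf hη z s))
      (fixedBase K ρ) := by
  set e : TwistedAlgebra ρ hf hη z s := mk ρ hf hη z s (X σ)
  have he : ∀ a, e * a = a := fun a => mk_X_mul hs hz (by omega) a
  have he' : ∀ a, a * e = a := fun a => mul_mk_X hs hz a
  have hC : ∀ κ : fixedBase K ρ, κ • e = mk ρ hf hη z s (C σ (algebraMap K L κ) * X σ) :=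
    fun κ => by
      have h := (mkHom ρ hf hη z s).map_smul κ (X σ)
      refine h.symm.trans ?_
      rw [Algebra.smul_def]
      rfl
  have hX1 : ∀ (i : ℕ) (γ : L), i ≠ 0 → i < f.natDegree →
      C σ γ * X σ ^ i ∈ twistedPolys σ ρ η f.natDegree := fun i γ h1 h2 =>
    C_mul_X_pow_mem_twistedPolys γ h1 h2
  refine IsoAsAlgebras.of_range _ (LinearMap.toSpanSingleton (fixedBase K ρ) _ e) ?_
    (fun κ μ => ?_) fun a => ⟨fun ha => ?_, ?_⟩
  · intro κ μ h
    have h2 := congrArg (spread ρ hf hη z s) h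
    have h1 : ∀ γ : L, C σ γ * X σ ∈ twistedPolys σ ρ η f.natDegree := fun γ => by
      simpa using hX1 1 γ one_ne_zero (by omega)
    rw [LinearMap.toSpanSingleton_apply, LinearMap.toSpanSingleton_apply, hC, hC,
      spread_mk (h1 _), spread_mk (h1 _)] at h2
    exact Subtype.ext ((algebraMap K L).injective
      (C_injective (mul_right_cancel₀ X_ne_zero h2)))
  · simp only [LinearMap.toSpanSingleton_apply, smul_mul_assoc, he, mul_smul]
  · obtain ⟨α, hα, h⟩ := (mem_leftNucleus_iff hs hz hF hFirr hFX hfirr hfF hσ hd hdN hη0).1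
      ha.1.1.1
    -- Commuting with `x ^ 2` compares `α x ^ 2` with `σ(α) x ^ 2`. Both are their own words since
    -- `2 < deg f`, so `σ` fixes `α`.
    have h1 := ha.2 (mk ρ hf hη z s (X σ ^ 2))
    rw [mk_X_sq_mul hs hz hd, ← h, mk_C_mul_X_mul hs hz (by omega), smul_mk, smul_mk,
      ← mul_assoc, X_mul_C, mul_assoc, ← pow_two] at h1
    have h2 := congrArg (spread ρ hf hη z s) h1
    rw [spread_mk (hX1 2 _ two_ne_zero hd), spread_mk (hX1 2 _ two_ne_zero hd)] at h2
    obtain ⟨c, rfl⟩ := mem_range_of_fixed hσ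
      (C_injective (mul_right_cancel₀ (pow_ne_zero 2 X_ne_zero) h2)).symm
    exact ⟨⟨c, hα⟩, (hC _).trans h⟩
  · rintro ⟨κ, rfl⟩
    rw [LinearMap.toSpanSingleton_apply]
    refine SMulMemClass.smul_mem κ ⟨⟨⟨fun b c => ?_, fun a c => ?_⟩, fun a b => ?_⟩, fun b => ?_⟩
    · rw [he, he]
    · rw [he, he']
    · rw [he', he']
    · rw [he, he']

end Nuclei

end TwistedAlgebra

end TwistedPoly

end

/-! ### Assembly of the theorem -/

open TwistedPoly in
theorem mainTheorem6 {K L : Type*} [Field K] [Field L] [Algebra K L] [FiniteDimensional K L]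
    [IsGalois K L] (σ : L ≃ₐ[K] L) (hσ : Subgroup.zpowers σ = ⊤)
    (ρ : L ≃+* L) [FiniteDimensional (fixedBase K ρ) K]
    (F : K[X]) (hF : F.Monic) (hFirr : Irreducible F) (hFX : F ≠ Polynomial.X)
    (f : TwistedPoly σ) (hf : f.Monic) (hfirr : Irreducible f)
    (hfF : ∃ g : TwistedPoly σ, g * f = central σ F) (hfc : f ∉ Set.center (TwistedPoly σ))
    (n s m ℓ : ℕ) (hn : n = Module.finrank K L) (hs : s = F.natDegree)
    (hm : IsProductOfIrreducibles (central σ F) m) (hℓ : ℓ = n / m) :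
    -- the codes
    (∀ (k : ℕ) (η : L), 1 ≤ k → 2 * k ≤ m → 2 < s * k * ℓ →
      (η ≠ 0 →
        Nonempty (leftIdealiser (twistedCode σ ρ η F (s * k * ℓ)) ≃ₐ[fixedBase K ρ]
          fixedElements (overBase K ρ)) ∧
        Nonempty (rightIdealiser (twistedCode σ ρ η F (s * k * ℓ)) ≃ₐ[fixedBase K ρ]
          fixedElements ((overBase K ρ)⁻¹ *
            (σ.restrictScalars (fixedBase K ρ)) ^ (s * k * ℓ))) ∧
        Nonempty (codeCentraliser (twistedCode σ ρ η F (s * k * ℓ)) ≃ₐ[fixedBase K ρ]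
          Subalgebra.center (fixedBase K ρ) (QuotientRing σ F)) ∧
        Nonempty (codeCentre (twistedCode σ ρ η F (s * k * ℓ)) ≃ₐ[fixedBase K ρ]
          fixedBase K ρ)) ∧
      (η = 0 →
        (leftIdealiser (twistedCode σ ρ η F (s * k * ℓ)) : Set (QuotientRing σ F)) =
          Set.range (fun a : L => Ideal.Quotient.mk _ (C σ a)) ∧
        (rightIdealiser (twistedCode σ ρ η F (s * k * ℓ)) : Set (QuotientRing σ F)) =
          Set.range (fun a : L => Ideal.Quotient.mk _ (C σ a)) ∧
        Nonempty (codeCentraliser (twistedCode σ ρ η F (s * k * ℓ)) ≃ₐ[fixedBase K ρ]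
          Subalgebra.center (fixedBase K ρ) (QuotientRing σ F)) ∧
        (codeCentre (twistedCode σ ρ η F (s * k * ℓ)) : Set (QuotientRing σ F)) =
          Set.range (fun c : K => Ideal.Quotient.mk _ (C σ (algebraMap K L c))))) ∧
    -- the algebras
    (∀ (η : L) (hη : Algebra.norm (fixedBase K ρ) (η * f.coeff 0) ≠ 1) (z : K[X]),
      central σ z * TwistedPoly.X σ ^ (s * n) - 1 ∈ Ideal.span {f} → η ≠ 0 → 2 < s * ℓ →
      -- unital, with unity `x`
      (∀ a : TwistedAlgebra ρ hf hη z s,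
        TwistedAlgebra.mk ρ hf hη z s (TwistedPoly.X σ) * a = a ∧
        a * TwistedAlgebra.mk ρ hf hη z s (TwistedPoly.X σ) = a) ∧
      -- a division algebra
      (∀ a : TwistedAlgebra ρ hf hη z s, a ≠ 0 →
        Function.Bijective (fun b => a * b) ∧ Function.Bijective (fun b => b * a)) ∧
      -- the nuclei and the centre
      IsoAsAlgebras (fixedBase K ρ)
        (leftNucleus (fixedBase K ρ) (TwistedAlgebra ρ hf hη z s))
        (fixedElements (overBase K ρ)) ∧
      IsoAsAlgebras (fixedBase K ρ)
        (middleNucleus (fixedBase K ρ) (TwistedAlgebra ρ hf hη z s))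
        (fixedElements ((overBase K ρ)⁻¹ * (σ.restrictScalars (fixedBase K ρ)) ^ (s * ℓ))) ∧
      IsoAsAlgebras (fixedBase K ρ)
        (rightNucleus (fixedBase K ρ) (TwistedAlgebra ρ hf hη z s))
        (Eigenring (fixedBase K ρ) f) ∧
      IsoAsAlgebras (fixedBase K ρ)
        (nonassocCentre (fixedBase K ρ) (TwistedAlgebra ρ hf hη z s))
        (fixedBase K ρ)) := by
  subst hn hs
  have hfF' : central σ F ∈ Ideal.span {f} := Ideal.mem_span_singleton'.2 hfF
  have hfd : f.natDegree = F.natDegree * ℓ :=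
    (natDegree_eq_mul_div hF hFirr hFX hσ hf hfirr hfF' hm).trans (by rw [hℓ])
  have hml : m * ℓ ≤ Module.finrank K L := hℓ ▸ Nat.mul_div_le _ _
  refine ⟨fun k η _ hkm hd => ?_, fun η hη z hz hη0 hd => ?_⟩
  · have hdN : 2 * (F.natDegree * k * ℓ) ≤ (central σ F).natDegree := by
      rw [natDegree_central hF]
      calc 2 * (F.natDegree * k * ℓ) = F.natDegree * (2 * k * ℓ) := by ring
        _ ≤ F.natDegree * (m * ℓ) := Nat.mul_le_mul_left _ (Nat.mul_le_mul_right _ hkm)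
        _ ≤ F.natDegree * Module.finrank K L := Nat.mul_le_mul_left _ hml
    have hcent : Nonempty (codeCentraliser (twistedCode σ ρ η F (F.natDegree * k * ℓ))
        ≃ₐ[fixedBase K ρ] Subalgebra.center (fixedBase K ρ) (QuotientRing σ F)) :=
      ⟨Subalgebra.equivOfEq _ _ (codeCentraliser_eq_center hF hFirr hFX hd)⟩
    refine ⟨fun hη => ⟨nonempty_leftIdealiser_equiv hF hFirr hFX hd hdN hη,
      nonempty_rightIdealiser_equiv hF hFirr hFX hd hdN hη, hcent,
      nonempty_codeCentre_equiv hF hFirr hFX hd hdN hσ hη⟩, ?_⟩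
    rintro rfl
    exact ⟨coe_leftIdealiser_zero hF hFirr hFX hd hdN, coe_rightIdealiser_zero hF hFirr hFX hd hdN,
      hcent, coe_codeCentre_zero hF hFirr hFX hd hdN hσ⟩
  · have hs := hFirr.natDegree_pos
    rw [← hfd] at hd ⊢
    -- The nuclei use the code with `k = 1`, and the bound it needs is `2 ≤ m`, which holds because
    -- `f` is not central.
    have hdN : 2 * f.natDegree ≤ (central σ F).natDegree := by
      rw [natDegree_central hF, ← mul_natDegree_eq hF hFirr hFX hσ hfirr hfF' hm]
      exact Nat.mul_le_mul_right _ (two_le_of_notMem_center hF hFirr hFX hσ hf hfirr hfF' hfc hm)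
    exact ⟨fun a => ⟨TwistedAlgebra.mk_X_mul hs hz (by omega) a,
        TwistedAlgebra.mul_mk_X hs hz a⟩,
      fun a ha => ⟨TwistedAlgebra.mul_left_bijective hs hz hfirr ha,
        TwistedAlgebra.mul_right_bijective hs hz hfirr ha⟩,
      TwistedAlgebra.leftNucleus_iso hs hz hF hFirr hFX hfirr hfF' hσ hd hdN hη0,
      TwistedAlgebra.middleNucleus_iso hs hz hF hFirr hFX hfirr hfF' hσ hd hdN hη0,
      TwistedAlgebra.rightNucleus_iso hs hz hd,
      TwistedAlgebra.nonassocCentre_iso hs hz hF hFirr hFX hfirr hfF' hσ hd hdN hη0⟩
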